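/- **Proposition (BRST invariance of $S+S_{\rm gf}+S_{\rm gh}$).** *Setting.* Let $M=\mathbb R^4/\Gamma$ be a closed flat Riemannian 4-manifold, where the group $\Gamma$ acts on $\mathbb R^4$ freely, properly discontinuously, cocompactly and by isometries (for a spin manifold $M$ the Dirac operator below is globally defined; only its local heat invariants, which make sense on every such $M$, are used). Fix an $SU(N)$-bundle over $M$ with a flat background connection $\partial_\mu$, given by a holonomy representation $\rho:\Gamma\to SU(N)$. Let $G=G_0\oplus G_1$ be a complex supercommutative Banach algebra (for example a Grassmann algebra). Let $A=A_\mu dx^\mu$ be a smooth one-form on $M$ with values in $G_0\otimes su(N)$, and let $C,\overline C$ be smooth sections with values in $G_1\otimes su(N)$ (ghost and antighost), all with values in the adjoint bundle; no reality condition is imposed on the coefficients in $G$. We use antihermitian generators, so that the covariant derivative is $\partial_\mu+A_\mu$, and $$D_A=i\gamma^\mu(\partial_\mu+A_\mu),\qquad \gamma^\mu\gamma^\nu+\gamma^\nu\gamma^\mu=2\delta^{\mu\nu},\quad \gamma^\mu\ \text{hermitian } 4\times 4 .$$ Let $f(x)=\int_{t>0}e^{-tx^2}g(t)\,dt$ with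 $g$ real, put $f_k=\int_{t>0}t^{-k/2}g(t)\,dt$, and assume that these integrals converge absolutely for all integers $k\le 4$ and that $f_0\neq 0$. Let $\xi\in\mathbb R\setminus\{0\}$. *Actions.* All actions are formal Laurent series in $\Lambda^{-1}$ with coefficients in $G$. The spectral action $\operatorname{tr} f(D_A/\Lambda)$ stands for its full asymptotic expansion $$S[A]=\sum_{m\ge 0}\Lambda^{4-m}f_{4-m}\int_M a_m(x,D_A^2),$$ where $a_m(x,D_A^2)$ is the Seeley–De Witt invariant of $D_A^2$, that is, the coefficient of $t^{(m-4)/2}$ in the small-$t$ expansion of the trace of the heat kernel of $D_A^2$ on the diagonal. With $c_k=\frac{(-1)^{k+1}}{8\pi^2}\frac{(k+1)!}{(2k+1)!\,(2k+3)}$ (the constants for which $\int a_{4+2k}=c_k\int\operatorname{tr}F_{\mu\nu}\Delta_A^kF^{\mu\nu}+O(F^3)$), $\Delta=-\partial^\mu\partial_\mu$ and $$\phi_\Lambda(\Delta)=(f_0c_0)^{-1}\sum_{k\ge 0}\Lambda^{-2k}f_{-2k}c_k\Delta^k,$$ the gauge-fixing and Faddeev–Popov ghost terms are $$S_{\rm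 gf}[A]=-\frac1{2\xi}\int_M\operatorname{tr}\,\partial_\mu A^\mu\,\phi_\Lambda(\Delta)(\partial_\nu A^\nu),\qquad S_{\rm gh}[A,\overline C,C]=-\int_M\operatorname{tr}\,\partial_\mu\overline C\,\phi_\Lambda(\Delta)\big(\partial^\mu C+[A^\mu,C]\big).$$ *Claim.* The sum $S[A]+S_{\rm gf}[A]+S_{\rm gh}[A,\overline C,C]$ is invariant under the BRST transformations $$sA_\mu=\partial_\mu C+[A_\mu,C],\qquad sC=-\tfrac12[C,C],\qquad s\overline C=\xi^{-1}\partial_\mu A^\mu,$$ where $[C,C]=2C^2$ is the graded commutator. That is, for every odd constant $\varepsilon\in G_1$ (so that $\varepsilon^2=0$), the sum takes the same value, as a formal series in $\Lambda$, at $(A,\overline C,C)$ and at $(A+\varepsilon\, sA,\ \overline C+\varepsilon\, s\overline C,\ C+\varepsilon\, sC)$. -/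

import Mathlib

open MeasureTheory
open scoped ContDiff Matrix

noncomputable section

namespace SpectralYM

/-! ### Grassmann coefficients

Fields take values in (matrices over) a `ℤ/2`-graded supercommutative Banach algebra `G`, with even
part `𝒢 0` and odd part `𝒢 1`; the standard example is a Grassmann algebra with finitely many
generators. -/

/-- The grading `𝒢` makes `G` a supercommutative Banach superalgebra. -/
structure IsSupercommutative {G : Type*} [NormedRing G] [NormedAlgebra ℂ G]
    (𝒢 : ZMod 2 → Submodule ℂ G) : Prop where
  isClosed : ∀ i, IsClosed (𝒢 i : Set G)
  even_comm : ∀ a ∈ 𝒢 0, ∀ b : G, a * b = b * a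
  odd_anticomm : ∀ a ∈ 𝒢 1, ∀ b ∈ 𝒢 1, a * b = -(b * a)

/-! ### The cut-off function -/

/-- A cut-off function `f(x) = ∫_{t>0} e^{-t x²} g(t) dt`, given by its Laplace density `g`, with
finite moments `f_k` for `k ≤ 4` and with `f_0 ≠ 0`. -/
structure CutOff where
  g : ℝ → ℝ
  integrable_moment : ∀ k : ℤ, k ≤ 4 →
    IntegrableOn (fun t : ℝ => t ^ (-(k : ℝ) / 2) * g t) (Set.Ioi 0)
  moment_zero_ne : (∫ t in Set.Ioi (0 : ℝ), g t) ≠ 0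

/-- The cut-off function itself, `f(x) = ∫_{t>0} e^{-t x²} g(t) dt`. -/
def CutOff.f (c : CutOff) (x : ℝ) : ℝ :=
  ∫ t in Set.Ioi (0 : ℝ), Real.exp (-t * x ^ 2) * c.g t

/-- `f_k = ∫_{t>0} t^{-k/2} g(t) dt`, the coefficient that multiplies `Λ^k` in the expansion of
`tr f(D_A/Λ)`. -/
def CutOff.moment (c : CutOff) (k : ℤ) : ℝ :=
  ∫ t in Set.Ioi (0 : ℝ), t ^ (-(k : ℝ) / 2) * c.g t

/-- The constants `c_k` in `∫ a_{4+2k}(x, D_A²) = c_k ∫ tr F_{μν} Δ_A^k F_{μν} + O(F³)`, where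
`F_{μν} = ∂_μ A_ν - ∂_ν A_μ + [A_μ, A_ν]` and `A` is antihermitian. -/
def quadCoeff (k : ℕ) : ℝ :=
  (-1) ^ (k + 1) / (8 * Real.pi ^ 2) *
    ((k + 1).factorial / ((2 * k + 1).factorial * (2 * k + 3)))

/-- The formal expansion `φ_Λ(Δ) = (f_0 c_0)⁻¹ ∑_k Λ^{-2k} f_{-2k} c_k Δ^k`:
`phiCoeff c j` is the scalar in front of `Λ^{-j} Δ^{j/2}`, which vanishes for odd `j`. -/
def phiCoeff (c : CutOff) (j : ℕ) : ℝ :=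
  if Even j then (c.moment 0 * quadCoeff 0)⁻¹ * (c.moment (-(j : ℤ)) * quadCoeff (j / 2)) else 0

/-! ### Flat space, gamma matrices, fields -/

/-- Euclidean 4-space, the universal cover of a closed flat 4-manifold. -/
abbrev E4 := EuclideanSpace ℝ (Fin 4)

/-- The standard orthonormal frame. -/
abbrev frame (μ : Fin 4) : E4 := EuclideanSpace.single μ 1

/-- Hermitian gamma matrices of the Euclidean Clifford algebra, `γ^μ γ^ν + γ^ν γ^μ = 2 δ^{μν}`. -/
structure IsGamma (γ : Fin 4 → Matrix (Fin 4) (Fin 4) ℂ) : Prop where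
  hermitian : ∀ μ, (γ μ).IsHermitian
  clifford : ∀ μ ν, γ μ * γ ν + γ ν * γ μ = if μ = ν then 2 else 0

/-- A standard (chiral) choice of gamma matrices. -/
def chiralGamma : Fin 4 → Matrix (Fin 4) (Fin 4) ℂ :=
  ![!![0, 0, 1, 0; 0, 0, 0, 1; 1, 0, 0, 0; 0, 1, 0, 0],
    !![0, 0, 0, -Complex.I; 0, 0, -Complex.I, 0; 0, Complex.I, 0, 0; Complex.I, 0, 0, 0],
    !![0, 0, 0, -1; 0, 0, 1, 0; 0, 1, 0, 0; -1, 0, 0, 0],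
    !![0, 0, -Complex.I, 0; 0, 0, 0, Complex.I; Complex.I, 0, 0, 0; 0, -Complex.I, 0, 0]]

theorem isGamma_chiralGamma : IsGamma chiralGamma := by
  constructor
  · intro μ
    ext i j
    fin_cases μ <;> fin_cases i <;> fin_cases j <;> simp [chiralGamma]
  · have h2 : (2 : Matrix (Fin 4) (Fin 4) ℂ) =
        !![2, 0, 0, 0; 0, 2, 0, 0; 0, 0, 2, 0; 0, 0, 0, 2] := by
      ext i j
      fin_cases i <;> fin_cases j <;> simp [Matrix.ofNat_apply]
    have h0 : (0 : Matrix (Fin 4) (Fin 4) ℂ) =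
        !![0, 0, 0, 0; 0, 0, 0, 0; 0, 0, 0, 0; 0, 0, 0, 0] := by
      ext i j
      fin_cases i <;> fin_cases j <;> rfl
    intro μ ν
    rw [h2, h0]
    fin_cases μ <;> fin_cases ν <;> simp [chiralGamma] <;> norm_num

section Fields

variable {N : ℕ} {G : Type*} [NormedRing G] [NormedAlgebra ℂ G]

/-- A matrix-valued function on flat space. -/
abbrev MatField (N : ℕ) (G : Type*) := E4 → Matrix (Fin N) (Fin N) G

/-- The partial derivative `∂_μ B`, entry by entry. -/
def pd (μ : Fin 4) (B : MatField N G) : MatField N G := fun x =>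
  Matrix.of fun a b => fderiv ℝ (fun y => B y a b) x (frame μ)

/-- The scalar Laplacian `Δ = -∂^μ ∂_μ`. -/
def lap (B : MatField N G) : MatField N G := fun x => -∑ μ, pd μ (pd μ B) x

/-- The divergence `∂_μ A^μ`. -/
def divergence (A : Fin 4 → MatField N G) : MatField N G := fun x => ∑ μ, pd μ (A μ) x

/-- The covariant derivative `∂_μ C + [A_μ, C]`. -/
def covD (A : Fin 4 → MatField N G) (C : MatField N G) (μ : Fin 4) : MatField N G := fun x =>
  pd μ C x + (A μ x * C x - C x * A μ x)

/-- The coefficient of `Λ^{-j}` in `φ_Λ(Δ) B`. -/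
def phiOp (c : CutOff) (j : ℕ) (B : MatField N G) : MatField N G := fun x =>
  phiCoeff c j • (lap^[j / 2] B) x

/-- Smooth fields with values in `su(N) ⊗ 𝒢 i`. No reality condition is imposed on the Grassmann
coefficients, so these values are the traceless matrices with entries in `𝒢 i`. -/
structure IsSmoothSU (𝒢 : ZMod 2 → Submodule ℂ G) (i : ZMod 2) (B : MatField N G) : Prop where
  smooth : ∀ a b, ContDiff ℝ ∞ (fun x => B x a b)
  mem : ∀ x a b, B x a b ∈ 𝒢 i
  trace_zero : ∀ x, (B x).trace = 0

/-! ### Descent to the closed flat manifold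

The manifold is `M = E4 / Γ`, and the `SU(N)`-bundle with its flat background connection `∂_μ` is
`(E4 × ℂ^N) / Γ` for a holonomy representation `ρ`. Fields on `M` are equivariant fields on `E4`. -/

variable {Γ : Type*} [Group Γ] [MulAction Γ E4]

/-- The conjugation `ρ(s) B ρ(s)⁻¹`. -/
def conjBy (ρ : Γ →* Matrix.specialUnitaryGroup (Fin N) ℂ) (s : Γ)
    (B : Matrix (Fin N) (Fin N) G) : Matrix (Fin N) (Fin N) G :=
  ((ρ s : Matrix (Fin N) (Fin N) ℂ).map (algebraMap ℂ G)) * B *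
    ((ρ s⁻¹ : Matrix (Fin N) (Fin N) ℂ).map (algebraMap ℂ G))

/-- A section over `M` of the adjoint bundle. -/
def IsAdjSection (ρ : Γ →* Matrix.specialUnitaryGroup (Fin N) ℂ) (B : MatField N G) : Prop :=
  ∀ (s : Γ) (x : E4), B (s • x) = conjBy ρ s (B x)

/-- A one-form `A_μ dx^μ` over `M` with values in the adjoint bundle: its pull-back along every deck
transformation `s` is its conjugate by `ρ(s)`. -/
def IsAdjOneForm (ρ : Γ →* Matrix.specialUnitaryGroup (Fin N) ℂ)
    (A : Fin 4 → MatField N G) : Prop :=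
  ∀ (s : Γ) (x : E4) (μ : Fin 4),
    ∑ ν, (fderiv ℝ (fun y : E4 => s • y) x (frame μ)) ν • A ν (s • x) = conjBy ρ s (A μ x)

/-- Gauge fields: smooth even `su(N)`-valued one-forms on `M`. -/
structure IsGaugeField (𝒢 : ZMod 2 → Submodule ℂ G)
    (ρ : Γ →* Matrix.specialUnitaryGroup (Fin N) ℂ) (A : Fin 4 → MatField N G) : Prop where
  smoothSU : ∀ μ, IsSmoothSU 𝒢 0 (A μ)
  equivariant : IsAdjOneForm ρ A

/-- Ghost (and antighost) fields: smooth odd `su(N)`-valued functions on `M`. -/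
structure IsGhostField (𝒢 : ZMod 2 → Submodule ℂ G)
    (ρ : Γ →* Matrix.specialUnitaryGroup (Fin N) ℂ) (C : MatField N G) : Prop where
  smoothSU : IsSmoothSU 𝒢 1 C
  equivariant : IsAdjSection ρ C

/-! ### Dirac operator and Seeley–De Witt invariants -/

/-- Sections of the spinor bundle tensored with the `SU(N)`-bundle, in coordinates. -/
abbrev SpinorField (N : ℕ) (G : Type*) := E4 → Fin 4 × Fin N → G

/-- `∇_μ ψ = (∂_μ + A_μ) ψ`. -/
def nabla (A : Fin 4 → MatField N G) (μ : Fin 4) (ψ : SpinorField N G) : SpinorField N G :=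
  fun x i => fderiv ℝ (fun y => ψ y i) x (frame μ) + ∑ b, A μ x i.2 b * ψ x (i.1, b)

/-- The Dirac operator `D_A = i γ^μ (∂_μ + A_μ)`. -/
def dirac (γ : Fin 4 → Matrix (Fin 4) (Fin 4) ℂ) (A : Fin 4 → MatField N G)
    (ψ : SpinorField N G) : SpinorField N G :=
  fun x i => ∑ μ, ∑ s, (Complex.I * γ μ i.1 s) • nabla A μ ψ x (s, i.2)

/-- The coefficient of `t^{m/2}` in `(2i√t ξ·∇ - t D_A²)^n`, as an operator on sections. -/
def symbolPower (γ : Fin 4 → Matrix (Fin 4) (Fin 4) ℂ) (A : Fin 4 → MatField N G) (ξ : E4) :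
    ℕ → ℕ → SpinorField N G → SpinorField N G
  | 0, m, ψ => if m = 0 then ψ else 0
  | _ + 1, 0, _ => 0
  | n + 1, 1, ψ => fun x i =>
      ∑ μ, (2 * Complex.I * (ξ μ : ℂ)) • nabla A μ (symbolPower γ A ξ n 0 ψ) x i
  | n + 1, m + 2, ψ => fun x i =>
      ∑ μ, (2 * Complex.I * (ξ μ : ℂ)) • nabla A μ (symbolPower γ A ξ n (m + 1) ψ) x i -
        dirac γ A (dirac γ A (symbolPower γ A ξ n m ψ)) x i

/-- The Seeley–De Witt invariant `a_m(x, D_A²)`: the coefficient of `t^{(m-4)/2}` in the expansion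
as `t → 0` of the trace of the heat kernel of `D_A²` on the diagonal,
`tr K_t(x,x) = (2π)⁻⁴ ∫ tr (e^{-iξx} e^{-t D_A²} e^{iξx})(x) dξ`. Since
`e^{-iξx} D_A² e^{iξx} = |ξ|² - 2i ξ·∇ + D_A²`, rescaling `ξ` by `√t` gives
`tr K_t(x,x) ~ (2π)⁻⁴ t⁻² ∑_n (1/n!) ∫ e^{-|ξ|²} tr ((2i√t ξ·∇ - t D_A²)^n 1)(x) dξ`,
and only `n ≤ m` contribute to order `t^{m/2}`. -/
def seeleyDeWitt (γ : Fin 4 → Matrix (Fin 4) (Fin 4) ℂ) (A : Fin 4 → MatField N G)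
    (m : ℕ) (x : E4) : G :=
  ((2 * Real.pi) ^ 4)⁻¹ • ∑ n ∈ Finset.range (m + 1), ((n.factorial : ℝ))⁻¹ •
    ∫ ξ : E4, Real.exp (-‖ξ‖ ^ 2) •
      ∑ i : Fin 4 × Fin N, symbolPower γ A ξ n m (fun _ => Pi.single i 1) x i

/-! ### The actions, as formal series in `Λ`

Laurent series are in the formal variable `Λ⁻¹`. Integrals over `M` are integrals over a fundamental
domain `F` of `Γ`. -/

/-- The asymptotically expanded spectral action
`S[A] ~ ∑_{m ≥ 0} Λ^{4-m} f_{4-m} ∫_M a_m(x, D_A²)` of `tr f(D_A/Λ)`. -/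
def spectralAction (c : CutOff) (γ : Fin 4 → Matrix (Fin 4) (Fin 4) ℂ) (F : Set E4)
    (A : Fin 4 → MatField N G) : LaurentSeries G :=
  HahnSeries.single (-4) 1 * HahnSeries.ofPowerSeries ℤ G (PowerSeries.mk fun m =>
    c.moment (4 - (m : ℤ)) • ∫ x in F, seeleyDeWitt γ A m x)

/-- The gauge-fixing term `-(1/2ξ) ∫ tr ∂_μ A^μ φ_Λ(Δ) (∂_ν A^ν)`. -/
def gaugeFixing (c : CutOff) (ξ : ℝ) (F : Set E4) (A : Fin 4 → MatField N G) :
    LaurentSeries G :=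
  HahnSeries.ofPowerSeries ℤ G (PowerSeries.mk fun j =>
    -(1 / (2 * ξ)) • ∫ x in F, (divergence A x * phiOp c j (divergence A) x).trace)

/-- The Faddeev–Popov term `-∫ tr ∂_μ C̄ φ_Λ(Δ) (∂^μ C + [A^μ, C])`. -/
def ghostAction (c : CutOff) (F : Set E4) (A : Fin 4 → MatField N G) (Cbar C : MatField N G) :
    LaurentSeries G :=
  HahnSeries.ofPowerSeries ℤ G (PowerSeries.mk fun j =>
    -∫ x in F, ∑ μ, (pd μ Cbar x * phiOp c j (covD A C μ) x).trace)

/-- `S[A] + S_gf[A] + S_gh[A, C̄, C]`. -/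
def totalAction (c : CutOff) (γ : Fin 4 → Matrix (Fin 4) (Fin 4) ℂ) (ξ : ℝ) (F : Set E4)
    (A : Fin 4 → MatField N G) (Cbar C : MatField N G) : LaurentSeries G :=
  spectralAction c γ F A + gaugeFixing c ξ F A + ghostAction c F A Cbar C

/-! ### BRST transformations -/

/-- `s A_μ = ∂_μ C + [A_μ, C]`. -/
def brstA (A : Fin 4 → MatField N G) (C : MatField N G) : Fin 4 → MatField N G :=
  fun μ => covD A C μ

/-- `s C = -½ [C, C]`, with the graded commutator `[C, C] = C C + C C` of the odd field `C`. -/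
def brstC (C : MatField N G) : MatField N G :=
  fun x => -((1 / 2 : ℝ) • (C x * C x + C x * C x))

/-- `s C̄ = ξ⁻¹ ∂_μ A^μ`. -/
def brstCbar (ξ : ℝ) (A : Fin 4 → MatField N G) : MatField N G :=
  fun x => ξ⁻¹ • divergence A x

end Fields

end SpectralYM

end

/-! The spectral action and the pair gauge-fixing plus ghost term are invariant separately, and in
both cases order by order in `Λ`.

Spectral action. Put `w = εC`. It is even and `w² = 0`, so `1 + w` is invertible with inverse `1 -
w`, and `A + ε sA` is the gauge transform of `A`: `∇' = (1 - w) ∇ (1 + w)` (`conj_connection`). No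
group exponential is needed, and the invariants `a_m(x, D_A²)` turn out to be invariant pointwise,
before integration. For this, `a_m` is written as the fibre trace of an operator `heatOp`, a
Gaussian average over `ξ` of noncommutative polynomials in `∇` and `D²`
(`seeleyDeWitt_eq_fibreTrace`). By construction `heatOp` is natural under algebra homomorphisms
(`heatOp_map`), hence under conjugation by `1 + w`. It remains to use cyclicity of the fibre trace,
which fails for differential operators; the essential point is that `heatOp` has order zero
(`isTensorial_heatOp`).

Order zero is proved algebraically. With `P = 2is ξ·∇ - s² D²`, the relations `[∇_μ, x_ν] = δ_{μν}`
and `[D², x_μ] = -2∇_μ` say that `[·, x_μ] + is ∂/∂ξ_μ` is a derivation sending `P` to the central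
element `2is ξ_μ`. So `[P^n, x_μ] = 2isn ξ_μ P^{n-1} - is ∂P^n/∂ξ_μ` (`symComm_symPow`). After
division by `n!` and integration against `e^{-|ξ|²}`, integration by parts (`gaussInt_pderiv`) makes
the sum over `n` telescope to zero (`heatOp_commute`). An operator commuting with coordinates and
even constants is a matrix at each point, by Hadamard's lemma (`IsTensorial.apply_eq`), and matrices
over the commutative even part have a cyclic trace (`fibreTrace_mul_comm`).

Gauge fixing and ghosts. Since `s² A = 0`, `∂^μ C + [A^μ, C]` does not change at all (`covD_brst`),
so only the antighost varies in the ghost term. Integrating by parts on `E4 / Γ`, and using that `Δ`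
is symmetric and commutes with the divergence, turns both variations into multiples of `ε ∫ tr ∂A
Δ^k ∂(sA)` with opposite coefficients. The cancellation holds separately for every power of `Δ`,
whatever the coefficients of `φ_Λ`. -/

noncomputable section

set_option linter.unusedSectionVars false

namespace SpectralYM

open scoped TensorProduct

/-! ### Formal calculus of polynomial symbols with operator coefficients -/

section SymbolAlgebra

/-- Polynomials in the covector `ξ` with coefficients in an algebra `R` of operators. -/
abbrev PolySymbol (R : Type*) [Ring R] [Algebra ℂ R] := MvPolynomial (Fin 4) ℂ ⊗[ℂ] R

variable {R : Type*} [Ring R] [Algebra ℂ R]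

/-- The partial derivative of a polynomial symbol in the direction `ξ_μ`. -/
def symDeriv (μ : Fin 4) : PolySymbol R →ₗ[ℂ] PolySymbol R :=
  LinearMap.rTensor R (MvPolynomial.pderiv μ).toLinearMap

/-- The polynomial symbol `ξ_μ`. -/
def symVar (μ : Fin 4) : PolySymbol R := MvPolynomial.X μ ⊗ₜ 1

/-- The polynomial symbol `2 i ξ·∇`. -/
def symLin (nab : Fin 4 → R) : PolySymbol R :=
  ∑ μ, (MvPolynomial.X μ : MvPolynomial (Fin 4) ℂ) ⊗ₜ[ℂ] ((2 * Complex.I) • nab μ)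

/-- The coefficient of `s^m` in `(2 i s ξ·∇ - s² D)^n`, as a polynomial symbol. -/
def symPow (nab : Fin 4 → R) (D : R) : ℕ → ℕ → PolySymbol R
  | 0, m => if m = 0 then 1 else 0
  | _ + 1, 0 => 0
  | n + 1, 1 => symLin nab * symPow nab D n 0
  | n + 1, m + 2 => symLin nab * symPow nab D n (m + 1) - (1 ⊗ₜ D) * symPow nab D n m

@[simp] theorem symDeriv_tmul (μ : Fin 4) (p : MvPolynomial (Fin 4) ℂ) (r : R) :
    symDeriv μ (p ⊗ₜ r) = MvPolynomial.pderiv μ p ⊗ₜ r := rfl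

theorem symDeriv_mul (μ : Fin 4) (a b : PolySymbol R) :
    symDeriv μ (a * b) = symDeriv μ a * b + a * symDeriv μ b := by
  induction a using TensorProduct.induction_on with
  | zero => simp
  | add a a' h h' => simp only [add_mul, map_add, h, h']; abel
  | tmul p r =>
    induction b using TensorProduct.induction_on with
    | zero => simp
    | add b b' h h' => simp only [mul_add, map_add, h, h']; abel
    | tmul q t =>
      simp only [Algebra.TensorProduct.tmul_mul_tmul, symDeriv_tmul, Derivation.leibniz,
        smul_eq_mul, TensorProduct.add_tmul, mul_comm q]
      abel

theorem symVar_commute (μ : Fin 4) (a : PolySymbol R) : symVar μ * a = a * symVar μ := by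
  induction a using TensorProduct.induction_on with
  | zero => simp
  | add a a' h h' => simp only [add_mul, mul_add, h, h']
  | tmul p r => simp [symVar, mul_comm]

theorem symDeriv_symLin (nab : Fin 4 → R) (μ : Fin 4) :
    symDeriv μ (symLin nab) = 1 ⊗ₜ ((2 * Complex.I) • nab μ) := by
  simp only [symLin, map_sum, symDeriv_tmul, MvPolynomial.pderiv_X]
  rw [Finset.sum_eq_single μ]
  · simp
  · intro ν _ h
    simp [h.symm]
  · simp

theorem symPow_eq_zero (nab : Fin 4 → R) (D : R) (n m : ℕ) (h : m < n) :
    symPow nab D n m = 0 := by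
  induction n generalizing m with
  | zero => omega
  | succ n ih =>
    match m with
    | 0 => rfl
    | 1 => rw [symPow, ih 0 (by omega), mul_zero]
    | m + 2 => rw [symPow, ih _ (by omega), ih _ (by omega)]; simp

/-- The commutator with an operator `x` of order zero. -/
def symComm (x : R) (a : PolySymbol R) : PolySymbol R := a * (1 ⊗ₜ x) - (1 ⊗ₜ x) * a

theorem symComm_mul (x : R) (a b : PolySymbol R) :
    symComm x (a * b) = symComm x a * b + a * symComm x b := by
  simp only [symComm, mul_sub, sub_mul, mul_assoc]; abel

theorem symComm_sub (x : R) (a b : PolySymbol R) :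
    symComm x (a - b) = symComm x a - symComm x b := by
  simp only [symComm, mul_sub, sub_mul]; abel

theorem symComm_symLin (nab x : Fin 4 → R)
    (h1 : ∀ μ ν, nab μ * x ν - x ν * nab μ = if μ = ν then 1 else 0) (μ : Fin 4) :
    symComm (x μ) (symLin nab) = (2 * Complex.I) • symVar μ := by
  simp only [symComm, symLin, Finset.sum_mul, Finset.mul_sum,
    Algebra.TensorProduct.tmul_mul_tmul, one_mul, mul_one, ← Finset.sum_sub_distrib,
    ← TensorProduct.tmul_sub, smul_mul_assoc, mul_smul_comm, ← smul_sub, h1]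
  rw [Finset.sum_eq_single μ]
  · simp [symVar]
  · intro ν _ h
    simp [h]
  · simp

variable (nab x : Fin 4 → R) (D : R)

theorem symComm_symPow_zero (μ : Fin 4) (n : ℕ) : symComm (x μ) (symPow nab D n 0) = 0 := by
  cases n <;> simp [symComm, symPow]

/-- The bookkeeping of the Leibniz rule in the induction for `symComm_symPow`. Here `v` stands for
`ξ_μ`, and `hn` encodes `P^n = P · P^{n-1}`; the factor `n` on both sides makes it true also for `n
= 0`, where `n - 1` is truncated. -/
theorem symComm_step {𝒜 : Type*} [Ring 𝒜] [Algebra ℂ 𝒜] {v a b X N D b' c' db dc : 𝒜} (n : ℂ)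
    (hX : v * X = X * v) (hD : v * D = D * v)
    (hn : n • (v * a) = n • (v * (X * b' - D * c'))) :
    ((2 * Complex.I) • v) * a + X * ((2 * Complex.I * n) • (v * b') - Complex.I • db) -
        (((-2 : ℂ) • N) * b + D * ((2 * Complex.I * n) • (v * c') - Complex.I • dc)) =
      (2 * Complex.I * (n + 1)) • (v * a) -
        Complex.I • (((2 * Complex.I) • N) * b + X * db - D * dc) := by
  have e1 : (2 * Complex.I * (n + 1)) • (v * a) =
      (2 * Complex.I) • (v * a) + (2 * Complex.I) • n • (v * a) := by module
  have e2 : ∀ y : 𝒜, X * (v * y) = v * (X * y) := fun y => by rw [← mul_assoc, ← hX, mul_assoc]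
  have e3 : ∀ y : 𝒜, D * (v * y) = v * (D * y) := fun y => by rw [← mul_assoc, ← hD, mul_assoc]
  have e4 : Complex.I • (2 * Complex.I) • (N * b) = (-2 : ℂ) • (N * b) := by
    rw [smul_smul]; congr 1; linear_combination 2 * Complex.I_mul_I
  rw [e1, hn]
  simp only [mul_sub, mul_smul_comm, smul_mul_assoc, e2, e3, smul_add, smul_sub, e4]
  module

/-- Both `[·, x_μ]` and `∂/∂ξ_μ` are derivations, and `[P, x_μ] = 2is ξ_μ - is ∂P/∂ξ_μ` for `P = 2is
ξ·∇ - s² D`. As `ξ_μ` is central this propagates to `P^n`; the formula is the coefficient of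
`s^(m+1)`. -/
theorem symComm_symPow
    (h1 : ∀ μ ν, nab μ * x ν - x ν * nab μ = if μ = ν then 1 else 0)
    (h2 : ∀ μ, D * x μ - x μ * D = (-2 : ℂ) • nab μ) (μ : Fin 4) (n m : ℕ) :
    symComm (x μ) (symPow nab D n (m + 1)) =
      (2 * Complex.I * n) • (symVar μ * symPow nab D (n - 1) m) -
        Complex.I • symDeriv μ (symPow nab D n m) := by
  have hone : symDeriv μ (1 : PolySymbol R) = 0 := by
    rw [Algebra.TensorProduct.one_def, symDeriv_tmul]; simp
  induction n generalizing m with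
  | zero =>
    rcases m with _ | m
    · simp [symPow, symComm, hone]
    · simp [symPow, symComm]
  | succ n ih =>
    have hX := symComm_symLin nab x h1 μ
    have hD : symComm (x μ) ((1 : MvPolynomial (Fin 4) ℂ) ⊗ₜ[ℂ] D) =
        (-2 : ℂ) • (1 ⊗ₜ nab μ) := by
      rw [symComm, Algebra.TensorProduct.tmul_mul_tmul, Algebra.TensorProduct.tmul_mul_tmul,
        ← TensorProduct.tmul_sub, h2, TensorProduct.tmul_smul, mul_one]
    have hD' : symDeriv μ ((1 : MvPolynomial (Fin 4) ℂ) ⊗ₜ[ℂ] D) = 0 := by simp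
    have hX' := symDeriv_symLin nab μ
    rw [TensorProduct.tmul_smul] at hX'
    rcases m with _ | m
    · have e : symPow nab D (n + 1) (0 + 1) = symLin nab * symPow nab D n 0 := rfl
      have e' : symPow nab D (n + 1) 0 = 0 := rfl
      rw [e, e', symComm_mul, hX, symComm_symPow_zero]
      rcases n with _ | n
      · simp [symPow]
      · simp [symPow]
    · have e : symPow nab D (n + 1) (m + 1 + 1) =
          symLin nab * symPow nab D n (m + 1) - (1 ⊗ₜ D) * symPow nab D n m := rfl
      rw [e, symComm_sub, symComm_mul, symComm_mul, hX, hD, ih, Nat.add_sub_cancel, Nat.cast_add,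
        Nat.cast_one]
      -- At the lowest order the factor multiplying `D` is the coefficient of `s^0`. It commutes
      -- with `x_μ`, so the corresponding terms are entered as zero.
      rcases m with _ | m
      · have := symComm_step (v := symVar μ) (a := symPow nab D n 1) (b := symPow nab D n 0)
          (X := symLin nab) (D := 1 ⊗ₜ D) (N := 1 ⊗ₜ nab μ) (b' := symPow nab D (n - 1) 0)
          (c' := 0) (db := symDeriv μ (symPow nab D n 0)) (dc := 0) n (symVar_commute _ _)
          (symVar_commute _ _) (by
            rcases n with _ | n
            · simp
            · simp [symPow])
        have e' : symPow nab D (n + 1) (0 + 1) = symLin nab * symPow nab D n 0 := rfl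
        rw [symComm_symPow_zero, e', symDeriv_mul, hX']
        simp only [mul_zero, smul_zero, sub_zero] at this ⊢
        exact this
      · have := symComm_step (v := symVar μ) (a := symPow nab D n (m + 2))
          (b := symPow nab D n (m + 1))
          (X := symLin nab) (D := 1 ⊗ₜ D) (N := 1 ⊗ₜ nab μ) (b' := symPow nab D (n - 1) (m + 1))
          (c' := symPow nab D (n - 1) m) (db := symDeriv μ (symPow nab D n (m + 1)))
          (dc := symDeriv μ (symPow nab D n m)) n (symVar_commute _ _)
          (symVar_commute _ _) (by
            rcases n with _ | n
            · simp
            · simp [symPow])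
        have e' : symPow nab D (n + 1) (m + 1 + 1) =
          symLin nab * symPow nab D n (m + 1) - (1 ⊗ₜ D) * symPow nab D n m := rfl
        rw [ih, e', map_sub, symDeriv_mul, symDeriv_mul, hX', hD', zero_mul, zero_add]
        exact this

variable (L : MvPolynomial (Fin 4) ℂ →ₗ[ℂ] ℂ)

/-- Apply a functional to the polynomial part of a symbol. -/
def symInt : PolySymbol R →ₗ[ℂ] R :=
  (TensorProduct.lid ℂ R).toLinearMap ∘ₗ LinearMap.rTensor R L

@[simp] theorem symInt_tmul (p : MvPolynomial (Fin 4) ℂ) (r : R) :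
    symInt L (p ⊗ₜ r) = L p • r := by simp [symInt]

theorem symInt_symComm (x : R) (a : PolySymbol R) :
    symInt L (symComm x a) = symInt L a * x - x * symInt L a := by
  induction a using TensorProduct.induction_on with
  | zero => simp [symComm]
  | add a b h h' =>
    have : symComm x (a + b) = symComm x a + symComm x b := by
      simp only [symComm, mul_add, add_mul]; abel
    rw [this, map_add, map_add, h, h']; noncomm_ring
  | tmul p r => simp [symComm]

theorem symInt_symDeriv (hL : ∀ μ p, L (MvPolynomial.pderiv μ p) = 2 * L (MvPolynomial.X μ * p))
    (μ : Fin 4) (a : PolySymbol R) :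
    symInt L (symDeriv μ a) = (2 : ℂ) • symInt L (symVar μ * a) := by
  induction a using TensorProduct.induction_on with
  | zero => simp
  | add a b h h' => simp only [map_add, mul_add, h, h', smul_add]
  | tmul p r => simp [symVar, hL, mul_smul]

/-- The formal heat coefficient of order `m`. -/
def heatOp (m : ℕ) : R :=
  ∑ n ∈ Finset.range (m + 1), ((n.factorial : ℂ))⁻¹ • symInt L (symPow nab D n m)

/-- With `hL`, the term `-i ∂P^n/∂ξ_μ` over `n!` integrates to `-2i ξ_μ P^n / n!`, while `2in ξ_μ
P^{n-1}` over `n!` is `2i ξ_μ P^{n-1} / (n-1)!`. The two sums over `n` differ by a shift of index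
and cancel. -/
theorem heatOp_commute
    (hL : ∀ μ p, L (MvPolynomial.pderiv μ p) = 2 * L (MvPolynomial.X μ * p))
    (h1 : ∀ μ ν, nab μ * x ν - x ν * nab μ = if μ = ν then 1 else 0)
    (h2 : ∀ μ, D * x μ - x μ * D = (-2 : ℂ) • nab μ) (m : ℕ) (μ : Fin 4) :
    heatOp nab D L m * x μ = x μ * heatOp nab D L m := by
  rw [← sub_eq_zero]
  simp only [heatOp, Finset.sum_mul, Finset.mul_sum, ← Finset.sum_sub_distrib, smul_mul_assoc,
    mul_smul_comm, ← smul_sub, ← symInt_symComm]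
  rcases m with _ | m
  · simp [symComm_symPow_zero]
  · simp only [symComm_symPow nab x D h1 h2, map_sub, map_smul, symInt_symDeriv L hL, smul_sub,
      Finset.sum_sub_distrib]
    -- The shift leaves two boundary terms: `n = 0` carries the factor `n`, and the last one
    -- vanishes because `P^(m+1)` has no coefficient of order `m`.
    rw [Finset.sum_range_succ', Finset.sum_range_succ _ (m + 1),
      symPow_eq_zero nab D (m + 1) m (by omega)]
    simp only [Nat.cast_zero, mul_zero, zero_smul, smul_zero, add_zero, map_zero,
      ← Finset.sum_sub_distrib]
    refine Finset.sum_eq_zero fun n _ => ?_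
    rw [smul_smul, smul_smul, smul_smul, Nat.add_sub_cancel, ← sub_smul]
    have hf : (n.factorial : ℂ) ≠ 0 := by exact_mod_cast n.factorial_ne_zero
    have hn : ((n : ℂ) + 1) ≠ 0 := by exact_mod_cast n.succ_ne_zero
    have : (((n + 1).factorial : ℂ))⁻¹ * (2 * Complex.I * ((n + 1 : ℕ) : ℂ)) -
        ((n.factorial : ℂ))⁻¹ * Complex.I * 2 = 0 := by
      rw [Nat.factorial_succ]; push_cast; field_simp; ring
    rw [this, zero_smul]

end SymbolAlgebra

/-! ### Gaussian integrals of polynomials and integration by parts -/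

section Gaussian

/-- Evaluation of polynomials on `E4`. -/
def polyEval (ξ : E4) : MvPolynomial (Fin 4) ℂ →ₐ[ℂ] ℂ :=
  MvPolynomial.aeval fun μ => (ξ μ : ℂ)

/-- For a monomial the integrand factorises over the four coordinates, which reduces the claim to
one-dimensional Gaussian moments. -/
theorem integrable_gaussian_mul_polyEval (p : MvPolynomial (Fin 4) ℂ) :
    Integrable fun ξ : E4 => (Real.exp (-‖ξ‖ ^ 2) : ℂ) * polyEval ξ p := by
  rw [p.as_sum]
  simp only [map_sum, Finset.mul_sum]
  refine integrable_finsetSum _ fun k _ => ?_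
  have h1 : ∀ n : ℕ, Integrable fun t : ℝ => (Real.exp (-t ^ 2) : ℂ) * (t : ℂ) ^ n := by
    intro n
    have := (integrable_rpow_mul_exp_neg_mul_sq (b := 1) one_pos (s := n)
      (by linarith [n.cast_nonneg (α := ℝ)])).ofReal (𝕜 := ℂ)
    refine this.congr (ae_of_all _ fun t => ?_)
    simp [mul_comm]
  have h2 := Integrable.fintype_prod (μ := fun _ : Fin 4 => (volume : Measure ℝ))
    (f := fun μ t => (Real.exp (-t ^ 2) : ℂ) * (t : ℂ) ^ (k μ)) fun μ => h1 (k μ)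
  have h3 := ((EuclideanSpace.volume_preserving_symm_measurableEquiv_toLp (Fin 4)).integrable_comp
    h2.aestronglyMeasurable).2 h2
  refine (h3.const_mul (p.coeff k)).congr (ae_of_all _ fun ξ => ?_)
  simp only [polyEval, MvPolynomial.aeval_monomial, Function.comp]
  rw [Finset.prod_mul_distrib, Finsupp.prod_fintype _ _ (by simp), EuclideanSpace.norm_sq_eq,
    ← Finset.sum_neg_distrib, Real.exp_sum]
  simp [mul_left_comm]

theorem hasLineDerivAt_polyEval (p : MvPolynomial (Fin 4) ℂ) (μ : Fin 4) (ξ : E4) :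
    HasLineDerivAt ℝ (fun ξ => polyEval ξ p) (polyEval ξ (MvPolynomial.pderiv μ p)) ξ
      (frame μ) := by
  unfold HasLineDerivAt
  induction p using MvPolynomial.induction_on with
  | C a => simpa [polyEval] using hasDerivAt_const (0 : ℝ) a
  | add p q hp hq => simpa using hp.fun_add hq
  | mul_X p ν hp =>
    have h : HasDerivAt (fun t : ℝ => polyEval (ξ + t • frame μ) (MvPolynomial.X ν))
        (polyEval ξ (MvPolynomial.pderiv μ (MvPolynomial.X ν))) 0 := by
      have : HasDerivAt (fun t : ℝ => ξ ν + t * (frame μ) ν) ((frame μ) ν) 0 := by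
        simpa using ((hasDerivAt_id (0 : ℝ)).mul_const ((frame μ) ν)).const_add (ξ ν)
      have h := this.ofReal_comp
      convert h using 1
      · ext t; simp [polyEval]
      · rw [MvPolynomial.pderiv_X]
        by_cases hμν : μ = ν
        · subst hμν; simp [frame, polyEval]
        · simp [frame, polyEval, Ne.symm hμν]
    have := hp.mul h
    simp only [map_mul, Derivation.leibniz, smul_eq_mul, map_add, zero_smul, add_zero] at this ⊢
    refine this.congr_deriv ?_
    ring

theorem hasLineDerivAt_gaussian (μ : Fin 4) (ξ : E4) :
    HasLineDerivAt ℝ (fun ξ : E4 => (Real.exp (-‖ξ‖ ^ 2) : ℂ))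
      ((Real.exp (-‖ξ‖ ^ 2) : ℂ) * (-2 * ξ μ)) ξ (frame μ) := by
  unfold HasLineDerivAt
  have h0 : ∀ t : ℝ, ‖ξ + t • frame μ‖ ^ 2 = ‖ξ‖ ^ 2 + (2 * ξ μ) * t + t ^ 2 := by
    intro t
    rw [norm_add_sq_real, inner_smul_right, norm_smul]
    simp [frame, EuclideanSpace.inner_single_right]
    ring
  have h1 : HasDerivAt (fun t : ℝ => -(‖ξ‖ ^ 2 + (2 * ξ μ) * t + t ^ 2)) (-(2 * ξ μ)) 0 := by
    have := ((((hasDerivAt_id' (0 : ℝ)).const_mul (2 * ξ μ)).const_add (‖ξ‖ ^ 2)).fun_add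
      ((hasDerivAt_id' (0 : ℝ)).fun_pow 2)).fun_neg
    simpa only [mul_one, Nat.cast_ofNat, pow_one, mul_zero, add_zero, Nat.add_one_sub_one] using this
  have h2 := h1.exp.ofReal_comp
  have e : (fun t : ℝ => (Real.exp (-‖ξ + t • frame μ‖ ^ 2) : ℂ)) =
      fun t : ℝ => ((Real.exp (-(‖ξ‖ ^ 2 + (2 * ξ μ) * t + t ^ 2)) : ℝ) : ℂ) := by
    funext t; rw [h0]
  rw [e]
  exact h2.congr_deriv (by simp)

/-- The Gaussian functional `p ↦ ∫ e^{-|ξ|²} p(ξ) dξ`. -/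
def gaussInt : MvPolynomial (Fin 4) ℂ →ₗ[ℂ] ℂ where
  toFun p := ∫ ξ : E4, (Real.exp (-‖ξ‖ ^ 2) : ℂ) * polyEval ξ p
  map_add' p q := by
    simp only [map_add, mul_add]
    exact integral_add (integrable_gaussian_mul_polyEval p) (integrable_gaussian_mul_polyEval q)
  map_smul' a p := by
    simp only [map_smul, smul_eq_mul, RingHom.id_apply, mul_left_comm _ a]
    exact integral_const_mul a _

theorem gaussInt_pderiv (μ : Fin 4) (p : MvPolynomial (Fin 4) ℂ) :
    gaussInt (MvPolynomial.pderiv μ p) = 2 * gaussInt (MvPolynomial.X μ * p) := by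
  have h : ∀ ξ : E4, (Real.exp (-‖ξ‖ ^ 2) : ℂ) * (-2 * ξ μ) * polyEval ξ p =
      -2 * ((Real.exp (-‖ξ‖ ^ 2) : ℂ) * polyEval ξ (MvPolynomial.X μ * p)) := by
    intro ξ
    simp only [map_mul, polyEval, MvPolynomial.aeval_X]
    ring
  have := integral_bilinear_hasLineDerivAt_right_eq_neg_left_of_integrable (μ := volume)
    (B := ContinuousLinearMap.mul ℝ ℂ)
    (f := fun ξ : E4 => (Real.exp (-‖ξ‖ ^ 2) : ℂ)) (g := fun ξ => polyEval ξ p) (v := frame μ)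
    (f' := fun ξ => (Real.exp (-‖ξ‖ ^ 2) : ℂ) * (-2 * ξ μ))
    (g' := fun ξ => polyEval ξ (MvPolynomial.pderiv μ p))
    (by
      simp only [ContinuousLinearMap.mul_apply', h]
      exact (integrable_gaussian_mul_polyEval _).const_mul _)
    (integrable_gaussian_mul_polyEval _) (integrable_gaussian_mul_polyEval p)
    (fun ξ _ => hasLineDerivAt_gaussian μ ξ) (fun ξ _ => hasLineDerivAt_polyEval p μ ξ)
  simp only [ContinuousLinearMap.mul_apply', h] at this
  rw [integral_const_mul] at this
  simp only [gaussInt, LinearMap.coe_mk, AddHom.coe_mk]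
  rw [this]; ring

end Gaussian

/-! ### Hadamard's lemma with values in a closed subspace -/

section Hadamard

/-- The weight `t ^ k` is there for the induction: each derivative in `y` replaces `f` by `fderiv ℝ
f` and produces one more factor `t`. This is also why the target space is generalised. -/
theorem contDiff_integral_homothety (x₀ : E4) (n k : ℕ) {F : Type*} [NormedAddCommGroup F]
    [NormedSpace ℝ F] {f : E4 → F} (hf : ContDiff ℝ ∞ f) :
    ContDiff ℝ n fun y => ∫ t in (0 : ℝ)..1, t ^ k • f (x₀ + t • (y - x₀)) := by
  induction n generalizing k F with
  | zero =>
    have hc := hf.continuous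
    exact contDiff_zero.2 (intervalIntegral.continuous_parametric_intervalIntegral_of_continuous'
      (by fun_prop) _ _)
  | succ n ih =>
    have hf' : ContDiff ℝ ∞ (fderiv ℝ f) := hf.fderiv_right (by simp)
    have hc := hf.continuous
    have hc' := hf'.continuous
    refine contDiff_succ_iff_hasFDerivAt.2 ⟨_, ih (k + 1) hf', fun y => ?_⟩
    have hcont : Continuous fun p : ℝ × E4 => p.1 ^ (k + 1) • fderiv ℝ f (x₀ + p.1 • (p.2 - x₀)) := by
      fun_prop
    -- Compactness of `[0,1]` times the unit ball around `y` gives the constant dominating the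
    -- derivative.
    obtain ⟨M, hM⟩ := ((isCompact_Icc (a := (0 : ℝ)) (b := 1)).prod
      (isCompact_closedBall y 1)).exists_bound_of_continuousOn hcont.continuousOn
    refine intervalIntegral.hasFDerivAt_integral_of_dominated_of_fderiv_le (bound := fun _ => M)
      (F' := fun y t => t ^ (k + 1) • fderiv ℝ f (x₀ + t • (y - x₀)))
      (Metric.closedBall_mem_nhds y one_pos)
      (Filter.Eventually.of_forall fun z => Continuous.aestronglyMeasurable (by fun_prop))
      (Continuous.intervalIntegrable (by fun_prop) _ _)
      (Continuous.aestronglyMeasurable (by fun_prop))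
      (ae_of_all _ fun t ht z hz => hM (t, z) ⟨?_, hz⟩) intervalIntegrable_const
      (ae_of_all _ fun t _ z _ => ?_)
    · rw [Set.uIoc_of_le zero_le_one] at ht
      exact ⟨ht.1.le, ht.2⟩
    · have h1 : HasFDerivAt (fun z => x₀ + t • (z - x₀)) (t • ContinuousLinearMap.id ℝ E4) z :=
        (((hasFDerivAt_id z).sub_const x₀).const_smul t).const_add x₀
      have h2 := ((hf.differentiable (by simp)).differentiableAt.hasFDerivAt.comp z h1).const_smul
        (t ^ k)
      refine h2.congr_fderiv ?_
      ext v
      simp [pow_succ, mul_smul]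

theorem fderiv_apply_mem {E F : Type*} [NormedAddCommGroup E] [NormedSpace ℝ E]
    [NormedAddCommGroup F] [NormedSpace ℝ F] (K : Submodule ℝ F) (hK : IsClosed (K : Set F))
    {f : E → F} (hf : Differentiable ℝ f) (hm : ∀ x, f x ∈ K) (x v : E) : fderiv ℝ f x v ∈ K := by
  have h1 : HasDerivAt (fun t : ℝ => f (x + t • v)) (fderiv ℝ f x v) 0 :=
    (hf x).hasFDerivAt.hasLineDerivAt v
  have h2 := range_deriv_subset_closure_span_image (𝕜 := ℝ) (fun t : ℝ => f (x + t • v))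
    dense_univ ⟨0, h1.deriv⟩
  refine closure_minimal ?_ hK h2
  refine Submodule.span_le.2 ?_
  rintro _ ⟨t, -, rfl⟩
  exact hm _

/-- Integrate the derivative of `f` along the segment from `x₀` to `y`. The remainders must stay in
`K` because they will be entries of even spinors, on which the operators act. -/
theorem hadamard_lemma {F : Type*} [NormedAddCommGroup F] [NormedSpace ℝ F] [CompleteSpace F]
    (K : Submodule ℝ F) (hK : IsClosed (K : Set F)) {f : E4 → F} (hf : ContDiff ℝ ∞ f)
    (hm : ∀ x, f x ∈ K) (x₀ : E4) :
    ∃ h : Fin 4 → E4 → F, (∀ μ, ContDiff ℝ ∞ (h μ)) ∧ (∀ μ x, h μ x ∈ K) ∧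
      ∀ y, f y = f x₀ + ∑ μ, (y μ - x₀ μ) • h μ y := by
  have hd : ∀ μ, ContDiff ℝ ∞ fun x => fderiv ℝ f x (frame μ) := fun μ =>
    (hf.fderiv_right (m := ∞) (by simp)).clm_apply contDiff_const
  have hline : ∀ (y : E4) μ, Continuous fun t : ℝ => fderiv ℝ f (x₀ + t • (y - x₀)) (frame μ) :=
    fun y μ => (hd μ).continuous.comp (by fun_prop)
  refine ⟨fun μ y => ∫ t in (0 : ℝ)..1, fderiv ℝ f (x₀ + t • (y - x₀)) (frame μ), fun μ => ?_,
    fun μ x => ?_, fun y => ?_⟩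
  · refine contDiff_infty.2 fun n => ?_
    simpa using contDiff_integral_homothety x₀ n 0 (hd μ)
  · beta_reduce
    -- The interval has length one, so the integral is an average and stays in the closed convex set
    -- `K`.
    rw [intervalIntegral.integral_of_le zero_le_one]
    have : IsProbabilityMeasure (volume.restrict (Set.Ioc (0 : ℝ) 1)) := ⟨by simp⟩
    refine K.convex.integral_mem hK (ae_of_all _ fun t =>
      fderiv_apply_mem K hK (hf.differentiable (by simp)) hm _ _) ?_
    exact ((hline x μ).intervalIntegrable 0 1).1
  · have h1 : ∀ t : ℝ, HasDerivAt (fun t : ℝ => f (x₀ + t • (y - x₀)))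
        (∑ μ, (y μ - x₀ μ) • fderiv ℝ f (x₀ + t • (y - x₀)) (frame μ)) t := by
      intro t
      have h2 : HasDerivAt (fun t : ℝ => x₀ + t • (y - x₀)) (y - x₀) t := by
        simpa using ((hasDerivAt_id' t).smul_const (y - x₀)).const_add x₀
      have h3 := ((hf.differentiable (by simp)) (x₀ + t • (y - x₀))).hasFDerivAt.comp_hasDerivAt t h2
      refine h3.congr_deriv ?_
      have h4 : y - x₀ = ∑ μ, (y μ - x₀ μ) • frame μ := by
        ext ν
        simp [frame, Finset.sum_apply, Pi.single_apply]
      conv_lhs => arg 2; rw [h4]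
      rw [map_sum]
      simp only [map_smul]
    have h5 := intervalIntegral.integral_eq_sub_of_hasDerivAt (a := 0) (b := 1) (fun t _ => h1 t)
      (Continuous.intervalIntegrable
        (continuous_finsetSum _ fun μ _ => (hline y μ).const_smul _) _ _)
    rw [intervalIntegral.integral_finsetSum (f := fun μ t =>
      (y μ - x₀ μ) • fderiv ℝ f (x₀ + t • (y - x₀)) (frame μ))
      fun μ _ => ((hline y μ).const_smul _).intervalIntegrable _ _] at h5
    simp only [intervalIntegral.integral_smul, one_smul, zero_smul, add_zero,
      add_sub_cancel] at h5
    rw [h5]; abel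

end Hadamard

/-! ### Functoriality of the symbol calculus -/

section SymbolFunctoriality

variable {R S : Type*} [Ring R] [Algebra ℂ R] [Ring S] [Algebra ℂ S]

open scoped TensorProduct

/-- Multiplicativity holds for evaluation at a point `ξ`, though not for the Gaussian functional. It
lets `symPow` be compared with the operators at fixed `ξ` before integrating. -/
theorem symInt_algHom_mul (e : MvPolynomial (Fin 4) ℂ →ₐ[ℂ] ℂ) (a b : PolySymbol R) :
    symInt e.toLinearMap (a * b) = symInt e.toLinearMap a * symInt e.toLinearMap b := by
  induction a using TensorProduct.induction_on with
  | zero => simp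
  | add a a' h h' => simp only [add_mul, map_add, h, h']
  | tmul p r =>
    induction b using TensorProduct.induction_on with
    | zero => simp
    | add b b' h h' => simp only [mul_add, map_add, h, h']
    | tmul q t => simp [smul_smul, mul_comm]

theorem symComm_symPow_eq_zero {nab : Fin 4 → R} {D z : R} (h1 : ∀ μ, nab μ * z = z * nab μ)
    (h2 : D * z = z * D) (n m : ℕ) : symComm z (symPow nab D n m) = 0 := by
  have hX : symComm z (symLin nab) = 0 := by
    rw [symComm, symLin, Finset.sum_mul, Finset.mul_sum, ← Finset.sum_sub_distrib]
    refine Finset.sum_eq_zero fun μ _ => ?_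
    rw [Algebra.TensorProduct.tmul_mul_tmul, Algebra.TensorProduct.tmul_mul_tmul, smul_mul_assoc,
      mul_smul_comm, h1, one_mul, mul_one, sub_self]
  have hD : symComm z ((1 : MvPolynomial (Fin 4) ℂ) ⊗ₜ[ℂ] D) = 0 := by simp [symComm, h2]
  induction n generalizing m with
  | zero => by_cases h : m = 0 <;> simp [symPow, symComm, h]
  | succ n ih =>
    match m with
    | 0 => simp [symPow, symComm]
    | 1 => rw [symPow, symComm_mul, hX, ih, zero_mul, mul_zero, add_zero]
    | m + 2 =>
      rw [symPow, symComm_sub, symComm_mul, symComm_mul, hX, hD, ih, ih]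
      simp

theorem heatOp_commute_of_commute {nab : Fin 4 → R} {D z : R}
    (L : MvPolynomial (Fin 4) ℂ →ₗ[ℂ] ℂ) (h1 : ∀ μ, nab μ * z = z * nab μ)
    (h2 : D * z = z * D) (m : ℕ) : heatOp nab D L m * z = z * heatOp nab D L m := by
  rw [← sub_eq_zero]
  simp only [heatOp, Finset.sum_mul, Finset.mul_sum, ← Finset.sum_sub_distrib, smul_mul_assoc,
    mul_smul_comm, ← smul_sub, ← symInt_symComm, symComm_symPow_eq_zero h1 h2]
  simp

theorem symPow_map (f : R →ₐ[ℂ] S) (nab : Fin 4 → R) (D : R) (n m : ℕ) :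
    Algebra.TensorProduct.map (AlgHom.id ℂ _) f (symPow nab D n m) =
      symPow (fun μ => f (nab μ)) (f D) n m := by
  have hX : Algebra.TensorProduct.map (AlgHom.id ℂ _) f (symLin nab) =
      symLin fun μ => f (nab μ) := by simp [symLin]
  induction n generalizing m with
  | zero => by_cases h : m = 0 <;> simp [symPow, h]
  | succ n ih =>
    match m with
    | 0 => simp [symPow]
    | 1 => rw [symPow, symPow, map_mul, hX, ih]
    | m + 2 =>
      rw [symPow, symPow, map_sub, map_mul, map_mul, hX, ih, ih]
      simp

/-- `heatOp` is a fixed noncommutative polynomial in its arguments. Used with `f` a conjugation,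
this is gauge covariance of the heat coefficients. -/
theorem heatOp_map (f : R →ₐ[ℂ] S) (nab : Fin 4 → R) (D : R)
    (L : MvPolynomial (Fin 4) ℂ →ₗ[ℂ] ℂ) (m : ℕ) :
    heatOp (fun μ => f (nab μ)) (f D) L m = f (heatOp nab D L m) := by
  have h : ∀ a : PolySymbol R,
      symInt L (Algebra.TensorProduct.map (AlgHom.id ℂ _) f a) = f (symInt L a) := by
    intro a
    induction a using TensorProduct.induction_on with
    | zero => simp
    | add a b ha hb => simp only [map_add, ha, hb]
    | tmul p r => simp
  simp only [heatOp, map_sum, map_smul, ← h, symPow_map]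

/-- Conjugation `r ↦ v r u` for mutually inverse `u` and `v`. -/
def conjAlgHom (u v : R) (huv : u * v = 1) (hvu : v * u = 1) : R →ₐ[ℂ] R :=
  AlgHom.ofLinearMap (LinearMap.mulLeft ℂ v ∘ₗ LinearMap.mulRight ℂ u) (by simpa using hvu)
    (fun x y => by
      simp only [LinearMap.comp_apply, LinearMap.mulLeft_apply, LinearMap.mulRight_apply]
      calc v * (x * y * u) = v * (x * 1 * (y * u)) := by rw [mul_one, mul_assoc]
        _ = _ := by rw [← huv]; noncomm_ring)

theorem conjAlgHom_apply (u v : R) (huv : u * v = 1) (hvu : v * u = 1) (r : R) :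
    conjAlgHom u v huv hvu r = v * (r * u) := rfl

end SymbolFunctoriality

/-! ### Commutators of an abstract Dirac operator -/

section AbstractDirac

variable {R : Type*} [Ring R] [Algebra ℂ R] (g nab : Fin 4 → R)

theorem abstractDirac_comm (x : Fin 4 → R) (hgx : ∀ μ ν, g μ * x ν = x ν * g μ)
    (hnx : ∀ μ ν, nab μ * x ν - x ν * nab μ = if μ = ν then 1 else 0) (ν : Fin 4) :
    (∑ μ, Complex.I • (g μ * nab μ)) * x ν - x ν * ∑ μ, Complex.I • (g μ * nab μ) =
      Complex.I • g ν := by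
  have h : ∀ μ, Complex.I • (g μ * nab μ) * x ν - x ν * Complex.I • (g μ * nab μ) =
      Complex.I • (g μ * if μ = ν then 1 else 0) := fun μ => by
    rw [smul_mul_assoc, mul_smul_comm, ← smul_sub, ← mul_assoc, ← hgx, mul_assoc, mul_assoc,
      ← mul_sub, hnx]
  rw [Finset.sum_mul, Finset.mul_sum, ← Finset.sum_sub_distrib,
    Finset.sum_congr rfl fun μ _ => h μ]
  simp

/-- From `[D, x_ν] = i γ^ν`, `[D², x_ν]` is `i` times the anticommutator of `D` with `γ^ν`, which
the Clifford relations reduce to `2i ∇_ν`. The curvature of `∇` does not enter. -/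
theorem abstractDirac_sq_comm (x : Fin 4 → R) (hgx : ∀ μ ν, g μ * x ν = x ν * g μ)
    (hnx : ∀ μ ν, nab μ * x ν - x ν * nab μ = if μ = ν then 1 else 0)
    (hgn : ∀ μ ν, g μ * nab ν = nab ν * g μ)
    (hg : ∀ μ ν, g μ * g ν + g ν * g μ = if μ = ν then (2 : ℂ) • 1 else 0) (ν : Fin 4) :
    (∑ μ, Complex.I • (g μ * nab μ)) * (∑ μ, Complex.I • (g μ * nab μ)) * x ν -
      x ν * ((∑ μ, Complex.I • (g μ * nab μ)) * (∑ μ, Complex.I • (g μ * nab μ))) =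
      (-2 : ℂ) • nab ν := by
  have h := abstractDirac_comm g nab x hgx hnx ν
  have e : ∀ D y : R, D * D * y - y * (D * D) = D * (D * y - y * D) + (D * y - y * D) * D := by
    intro D y; noncomm_ring
  have h2 : ∀ μ, Complex.I • (g μ * nab μ) * g ν + g ν * Complex.I • (g μ * nab μ) =
      Complex.I • ((if μ = ν then (2 : ℂ) • 1 else 0) * nab μ) := fun μ => by
    rw [smul_mul_assoc, mul_smul_comm, mul_assoc, ← hgn, ← mul_assoc, ← mul_assoc, ← smul_add,
      ← add_mul, hg]
  rw [e, h, mul_smul_comm, smul_mul_assoc, ← smul_add, Finset.sum_mul, Finset.mul_sum,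
    ← Finset.sum_add_distrib, Finset.sum_congr rfl fun μ _ => h2 μ, Finset.sum_eq_single ν]
  · rw [if_pos rfl, smul_mul_assoc, one_mul, smul_smul, smul_smul,
      Complex.I_mul_I, neg_one_mul]
  · intro μ _ hμ
    rw [if_neg hμ, zero_mul, smul_zero]
  · simp

theorem abstractDirac_commute {z : R} (hgz : ∀ μ, g μ * z = z * g μ)
    (hnz : ∀ μ, nab μ * z = z * nab μ) :
    (∑ μ, Complex.I • (g μ * nab μ)) * z = z * ∑ μ, Complex.I • (g μ * nab μ) := by
  rw [Finset.sum_mul, Finset.mul_sum]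
  refine Finset.sum_congr rfl fun μ _ => ?_
  rw [smul_mul_assoc, mul_smul_comm, mul_assoc, hnz, ← mul_assoc, hgz, mul_assoc]

end AbstractDirac

/-! ### Concrete operators on even spinor fields and their commutation relations -/

section SpinorOperators

variable {N : ℕ} {G : Type*} [NormedRing G] [NormedAlgebra ℂ G]
  {𝒢 : ZMod 2 → Submodule ℂ G} [GradedAlgebra 𝒢]

theorem mul_mem_even {a b : G} (ha : a ∈ 𝒢 0) (hb : b ∈ 𝒢 0) : a * b ∈ 𝒢 0 := by
  simpa using SetLike.mul_mem_graded ha hb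

theorem one_mem_even : (1 : G) ∈ 𝒢 0 := SetLike.one_mem_graded 𝒢

theorem real_smul_mem {i : ZMod 2} {a : G} (r : ℝ) (ha : a ∈ 𝒢 i) : r • a ∈ 𝒢 i := by
  rw [← Complex.coe_smul]; exact (𝒢 i).smul_mem _ ha

theorem fderiv_mem_graded (h𝒢 : IsSupercommutative 𝒢) {i : ZMod 2} {f : E4 → G}
    (hf : ContDiff ℝ ∞ f) (hm : ∀ x, f x ∈ 𝒢 i) (x v : E4) : fderiv ℝ f x v ∈ 𝒢 i :=
  fderiv_apply_mem ((𝒢 i).restrictScalars ℝ) (h𝒢.isClosed i) (hf.differentiable (by simp)) hm x v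

theorem contDiff_fderiv_apply {F : Type*} [NormedAddCommGroup F] [NormedSpace ℝ F] {f : E4 → F}
    (hf : ContDiff ℝ ∞ f) (v : E4) : ContDiff ℝ ∞ fun x => fderiv ℝ f x v :=
  (hf.fderiv_right (m := ∞) (by simp)).clm_apply contDiff_const

variable (N 𝒢) in
/-- Smooth spinor fields with even coefficients. -/
def evenSpinor : Submodule ℂ (SpinorField N G) where
  carrier := {ψ | ∀ i, ContDiff ℝ ∞ (fun x => ψ x i) ∧ ∀ x, ψ x i ∈ 𝒢 0}
  add_mem' h h' i := ⟨(h i).1.add (h' i).1, fun x => (𝒢 0).add_mem ((h i).2 x) ((h' i).2 x)⟩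
  zero_mem' _ := ⟨contDiff_const, fun _ => (𝒢 0).zero_mem⟩
  smul_mem' c _ h i := ⟨(h i).1.const_smul c, fun x => (𝒢 0).smul_mem c ((h i).2 x)⟩

/-- Matrix fields with smooth entries in the even part. -/
structure IsEvenField (𝒢 : ZMod 2 → Submodule ℂ G) (B : MatField N G) : Prop where
  smooth : ∀ a b, ContDiff ℝ ∞ (fun x => B x a b)
  mem : ∀ x a b, B x a b ∈ 𝒢 0

variable (𝒢) in
/-- Left multiplication by an even constant. -/
def scalarOp (g : 𝒢 0) : Module.End ℂ (evenSpinor N 𝒢) where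
  toFun ψ := ⟨fun x i => (g : G) * ψ.1 x i, fun i =>
    ⟨contDiff_const.mul (ψ.2 i).1, fun x => mul_mem_even g.2 ((ψ.2 i).2 x)⟩⟩
  map_add' ψ φ := by ext x i; simp [mul_add]
  map_smul' c ψ := by ext x i; simp

variable (N 𝒢) in
/-- Multiplication by a coordinate function. -/
def coordOp (μ : Fin 4) : Module.End ℂ (evenSpinor N 𝒢) where
  toFun ψ := ⟨fun x i => x μ • ψ.1 x i, fun i =>
    ⟨((EuclideanSpace.proj μ : E4 →L[ℝ] ℝ).contDiff).smul (ψ.2 i).1, fun x => real_smul_mem _ ((ψ.2 i).2 x)⟩⟩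
  map_add' ψ φ := by ext x i; simp
  map_smul' c ψ := by ext x i; simp [smul_comm c]

/-- Pointwise multiplication by an even matrix field. -/
def matOp {B : MatField N G} (hB : IsEvenField 𝒢 B) : Module.End ℂ (evenSpinor N 𝒢) where
  toFun ψ := ⟨fun x i => ∑ b, B x i.2 b * ψ.1 x (i.1, b), fun i =>
    ⟨ContDiff.sum fun b _ => (hB.smooth _ _).mul (ψ.2 _).1,
      fun x => Submodule.sum_mem _ fun b _ => mul_mem_even (hB.mem _ _ _) ((ψ.2 _).2 x)⟩⟩
  map_add' ψ φ := by ext x i; simp [mul_add, Finset.sum_add_distrib]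
  map_smul' c ψ := by ext x i; simp [Finset.smul_sum]

variable (N 𝒢) in
/-- The action of a gamma matrix. -/
def gammaOp (g : Matrix (Fin 4) (Fin 4) ℂ) : Module.End ℂ (evenSpinor N 𝒢) where
  toFun ψ := ⟨fun x i => ∑ s, g i.1 s • ψ.1 x (s, i.2), fun i =>
    ⟨ContDiff.sum fun b _ => (ψ.2 _).1.const_smul _,
      fun x => Submodule.sum_mem _ fun b _ => (𝒢 0).smul_mem _ ((ψ.2 _).2 x)⟩⟩
  map_add' ψ φ := by ext x i; simp [Finset.sum_add_distrib]
  map_smul' c ψ := by ext x i; simp [Finset.smul_sum, smul_comm c]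

/-- The partial derivative. -/
def pdOp (h𝒢 : IsSupercommutative 𝒢) (μ : Fin 4) : Module.End ℂ (evenSpinor N 𝒢) where
  toFun ψ := ⟨fun x i => fderiv ℝ (fun y => ψ.1 y i) x (frame μ), fun i =>
    ⟨contDiff_fderiv_apply (ψ.2 i).1 _, fun x => fderiv_mem_graded h𝒢 (ψ.2 i).1 (ψ.2 i).2 _ _⟩⟩
  map_add' ψ φ := by
    ext x i
    have h1 := (ψ.2 i).1.differentiable (by simp) x
    have h2 := (φ.2 i).1.differentiable (by simp) x
    simp [fderiv_fun_add h1 h2]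
  map_smul' c ψ := by
    ext x i
    have h1 := (ψ.2 i).1.differentiable (by simp) x
    simp [fderiv_fun_const_smul h1 c]

/-- The covariant derivative. -/
def nablaOp (h𝒢 : IsSupercommutative 𝒢) {A : Fin 4 → MatField N G}
    (hA : ∀ μ, IsEvenField 𝒢 (A μ)) (μ : Fin 4) : Module.End ℂ (evenSpinor N 𝒢) :=
  pdOp h𝒢 μ + matOp (hA μ)

/-- The Dirac operator. -/
def diracOp (h𝒢 : IsSupercommutative 𝒢) (γ : Fin 4 → Matrix (Fin 4) (Fin 4) ℂ)
    {A : Fin 4 → MatField N G} (hA : ∀ μ, IsEvenField 𝒢 (A μ)) :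
    Module.End ℂ (evenSpinor N 𝒢) :=
  ∑ μ, Complex.I • (gammaOp N 𝒢 (γ μ) * nablaOp h𝒢 hA μ)

theorem evenSpinor_sum_apply {ι : Type*} (s : Finset ι) (f : ι → evenSpinor N 𝒢) (x : E4)
    (i : Fin 4 × Fin N) : (∑ k ∈ s, f k).1 x i = ∑ k ∈ s, (f k).1 x i := by
  rw [AddSubmonoidClass.coe_finsetSum, Finset.sum_apply, Finset.sum_apply]

theorem diracOp_apply (h𝒢 : IsSupercommutative 𝒢) (γ : Fin 4 → Matrix (Fin 4) (Fin 4) ℂ)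
    {A : Fin 4 → MatField N G} (hA : ∀ μ, IsEvenField 𝒢 (A μ)) (ψ : evenSpinor N 𝒢) :
    (diracOp h𝒢 γ hA ψ).1 = dirac γ A ψ.1 := by
  ext x i
  rw [diracOp, LinearMap.sum_apply, evenSpinor_sum_apply]
  refine Finset.sum_congr rfl fun μ _ => ?_
  change Complex.I • ∑ s, γ μ i.1 s • nabla A μ ψ.1 x (s, i.2) = _
  rw [Finset.smul_sum]
  refine Finset.sum_congr rfl fun s _ => ?_
  rw [smul_smul]

theorem gammaOp_mul (g h : Matrix (Fin 4) (Fin 4) ℂ) :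
    gammaOp N 𝒢 g * gammaOp N 𝒢 h = gammaOp N 𝒢 (g * h) := by
  ext ψ x i
  change ∑ s, g i.1 s • ∑ t, h s t • ψ.1 x (t, i.2) = ∑ t, (g * h) i.1 t • ψ.1 x (t, i.2)
  simp only [Finset.smul_sum, Matrix.mul_apply, Finset.sum_smul, smul_smul]
  exact Finset.sum_comm

theorem gammaOp_add (g h : Matrix (Fin 4) (Fin 4) ℂ) :
    gammaOp N 𝒢 g + gammaOp N 𝒢 h = gammaOp N 𝒢 (g + h) := by
  ext ψ x i
  change ∑ s, g i.1 s • ψ.1 x (s, i.2) + ∑ s, h i.1 s • ψ.1 x (s, i.2) =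
    ∑ s, (g + h) i.1 s • ψ.1 x (s, i.2)
  simp [add_smul, Finset.sum_add_distrib]

theorem gammaOp_two : gammaOp N 𝒢 2 = (2 : ℂ) • 1 := by
  ext ψ x i
  change ∑ s, (2 : Matrix (Fin 4) (Fin 4) ℂ) i.1 s • ψ.1 x (s, i.2) = (2 : ℂ) • ψ.1 x i
  simp [Matrix.ofNat_apply]

theorem gammaOp_zero : gammaOp N 𝒢 0 = 0 := by
  ext ψ x i
  change ∑ s, (0 : Matrix (Fin 4) (Fin 4) ℂ) i.1 s • ψ.1 x (s, i.2) = 0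
  simp

theorem gammaOp_commute_pdOp (h𝒢 : IsSupercommutative 𝒢) (g : Matrix (Fin 4) (Fin 4) ℂ)
    (μ : Fin 4) : gammaOp N 𝒢 g * pdOp h𝒢 μ = pdOp h𝒢 μ * gammaOp N 𝒢 g := by
  ext ψ x i
  change ∑ s, g i.1 s • fderiv ℝ (fun y => ψ.1 y (s, i.2)) x (frame μ) =
    fderiv ℝ (fun y => ∑ s, g i.1 s • ψ.1 y (s, i.2)) x (frame μ)
  have h : ∀ s, DifferentiableAt ℝ (fun y => ψ.1 y (s, i.2)) x := fun s =>
    (ψ.2 _).1.differentiable (by simp) x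
  have h' : HasFDerivAt (fun y => ∑ s, g i.1 s • ψ.1 y (s, i.2))
      (∑ s, g i.1 s • fderiv ℝ (fun y => ψ.1 y (s, i.2)) x) x :=
    HasFDerivAt.fun_sum fun s _ => (h s).hasFDerivAt.fun_const_smul (g i.1 s)
  rw [h'.fderiv, sum_apply]
  rfl

theorem gammaOp_commute_matOp {B : MatField N G} (hB : IsEvenField 𝒢 B)
    (g : Matrix (Fin 4) (Fin 4) ℂ) : gammaOp N 𝒢 g * matOp hB = matOp hB * gammaOp N 𝒢 g := by
  ext ψ x i
  change ∑ s, g i.1 s • ∑ b, B x i.2 b * ψ.1 x (s, b) =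
    ∑ b, B x i.2 b * ∑ s, g i.1 s • ψ.1 x (s, b)
  simp only [Finset.smul_sum, Finset.mul_sum, mul_smul_comm]
  exact Finset.sum_comm

theorem gammaOp_commute_nablaOp (h𝒢 : IsSupercommutative 𝒢) {A : Fin 4 → MatField N G}
    (hA : ∀ μ, IsEvenField 𝒢 (A μ)) (g : Matrix (Fin 4) (Fin 4) ℂ) (μ : Fin 4) :
    gammaOp N 𝒢 g * nablaOp h𝒢 hA μ = nablaOp h𝒢 hA μ * gammaOp N 𝒢 g := by
  rw [nablaOp, mul_add, add_mul, gammaOp_commute_pdOp, gammaOp_commute_matOp]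

theorem gammaOp_commute_coordOp (g : Matrix (Fin 4) (Fin 4) ℂ) (μ : Fin 4) :
    gammaOp N 𝒢 g * coordOp N 𝒢 μ = coordOp N 𝒢 μ * gammaOp N 𝒢 g := by
  ext ψ x i
  change ∑ s, g i.1 s • x μ • ψ.1 x (s, i.2) = x μ • ∑ s, g i.1 s • ψ.1 x (s, i.2)
  simp only [Finset.smul_sum, smul_comm (x μ)]

theorem gammaOp_commute_scalarOp (g : Matrix (Fin 4) (Fin 4) ℂ) (z : 𝒢 0) :
    gammaOp N 𝒢 g * scalarOp 𝒢 z = scalarOp 𝒢 z * gammaOp N 𝒢 g := by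
  ext ψ x i
  change ∑ s, g i.1 s • ((z : G) * ψ.1 x (s, i.2)) = z * ∑ s, g i.1 s • ψ.1 x (s, i.2)
  simp only [Finset.mul_sum, mul_smul_comm]

theorem matOp_commute_coordOp {B : MatField N G} (hB : IsEvenField 𝒢 B) (μ : Fin 4) :
    matOp hB * coordOp N 𝒢 μ = coordOp N 𝒢 μ * matOp hB := by
  ext ψ x i
  change ∑ b, B x i.2 b * (x μ • ψ.1 x (i.1, b)) = x μ • ∑ b, B x i.2 b * ψ.1 x (i.1, b)
  simp only [Finset.smul_sum, mul_smul_comm]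

theorem matOp_commute_scalarOp (h𝒢 : IsSupercommutative 𝒢) {B : MatField N G}
    (hB : IsEvenField 𝒢 B) (z : 𝒢 0) : matOp hB * scalarOp 𝒢 z = scalarOp 𝒢 z * matOp hB := by
  ext ψ x i
  change ∑ b, B x i.2 b * (z * ψ.1 x (i.1, b)) = z * ∑ b, B x i.2 b * ψ.1 x (i.1, b)
  rw [Finset.mul_sum]
  refine Finset.sum_congr rfl fun b _ => ?_
  rw [← mul_assoc, ← mul_assoc, h𝒢.even_comm z z.2]

theorem pdOp_commute_scalarOp (h𝒢 : IsSupercommutative 𝒢) (μ : Fin 4) (z : 𝒢 0) :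
    pdOp h𝒢 μ * scalarOp (N := N) 𝒢 z = scalarOp 𝒢 z * pdOp h𝒢 μ := by
  ext ψ x i
  change fderiv ℝ (fun y => (z : G) * ψ.1 y i) x (frame μ) =
    z * fderiv ℝ (fun y => ψ.1 y i) x (frame μ)
  rw [fderiv_const_mul ((ψ.2 _).1.differentiable (by simp) x)]
  rfl

theorem pdOp_comm_coordOp (h𝒢 : IsSupercommutative 𝒢) (μ ν : Fin 4) :
    pdOp h𝒢 μ * coordOp N 𝒢 ν - coordOp N 𝒢 ν * pdOp h𝒢 μ = if μ = ν then 1 else 0 := by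
  ext ψ x i
  have h0 : HasFDerivAt (fun y : E4 => y ν)
      (EuclideanSpace.proj ν : E4 →L[ℝ] ℝ) x := (EuclideanSpace.proj ν : E4 →L[ℝ] ℝ).hasFDerivAt
  have h1 : fderiv ℝ (fun y : E4 => y ν • ψ.1 y i) x (frame μ) =
      x ν • fderiv ℝ (fun y => ψ.1 y i) x (frame μ) + (frame μ ν) • ψ.1 x i := by
    rw [fderiv_fun_smul h0.differentiableAt ((ψ.2 _).1.differentiable (by simp) x), h0.fderiv]
    simp
  change fderiv ℝ (fun y => y ν • ψ.1 y i) x (frame μ) -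
    x ν • fderiv ℝ (fun y => ψ.1 y i) x (frame μ) = _
  rw [h1, add_sub_cancel_left]
  by_cases h : μ = ν
  · subst h; simp
  · simp [h, Ne.symm h]

theorem nablaOp_comm_coordOp (h𝒢 : IsSupercommutative 𝒢) {A : Fin 4 → MatField N G}
    (hA : ∀ μ, IsEvenField 𝒢 (A μ)) (μ ν : Fin 4) :
    nablaOp h𝒢 hA μ * coordOp N 𝒢 ν - coordOp N 𝒢 ν * nablaOp h𝒢 hA μ =
      if μ = ν then 1 else 0 := by
  rw [← pdOp_comm_coordOp h𝒢, nablaOp, add_mul, mul_add, matOp_commute_coordOp]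
  abel

theorem gammaOp_clifford {γ : Fin 4 → Matrix (Fin 4) (Fin 4) ℂ} (hγ : IsGamma γ) (μ ν : Fin 4) :
    gammaOp N 𝒢 (γ μ) * gammaOp N 𝒢 (γ ν) + gammaOp N 𝒢 (γ ν) * gammaOp N 𝒢 (γ μ) =
      if μ = ν then (2 : ℂ) • 1 else 0 := by
  rw [gammaOp_mul, gammaOp_mul, gammaOp_add, hγ.clifford]
  split_ifs
  · exact gammaOp_two
  · exact gammaOp_zero

theorem diracOp_sq_comm_coordOp (h𝒢 : IsSupercommutative 𝒢)
    {γ : Fin 4 → Matrix (Fin 4) (Fin 4) ℂ} (hγ : IsGamma γ)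
    {A : Fin 4 → MatField N G} (hA : ∀ μ, IsEvenField 𝒢 (A μ)) (ν : Fin 4) :
    diracOp h𝒢 γ hA * diracOp h𝒢 γ hA * coordOp N 𝒢 ν -
      coordOp N 𝒢 ν * (diracOp h𝒢 γ hA * diracOp h𝒢 γ hA) = (-2 : ℂ) • nablaOp h𝒢 hA ν :=
  abstractDirac_sq_comm (fun μ => gammaOp N 𝒢 (γ μ)) (nablaOp h𝒢 hA) (coordOp N 𝒢)
    (fun _ _ => gammaOp_commute_coordOp _ _) (nablaOp_comm_coordOp h𝒢 hA)
    (fun _ _ => gammaOp_commute_nablaOp h𝒢 hA _ _) (gammaOp_clifford hγ) ν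

theorem nablaOp_commute_scalarOp (h𝒢 : IsSupercommutative 𝒢) {A : Fin 4 → MatField N G}
    (hA : ∀ μ, IsEvenField 𝒢 (A μ)) (μ : Fin 4) (z : 𝒢 0) :
    nablaOp h𝒢 hA μ * scalarOp 𝒢 z = scalarOp 𝒢 z * nablaOp h𝒢 hA μ := by
  rw [nablaOp, add_mul, mul_add, pdOp_commute_scalarOp, matOp_commute_scalarOp h𝒢]

theorem diracOp_commute_scalarOp (h𝒢 : IsSupercommutative 𝒢)
    (γ : Fin 4 → Matrix (Fin 4) (Fin 4) ℂ) {A : Fin 4 → MatField N G}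
    (hA : ∀ μ, IsEvenField 𝒢 (A μ)) (z : 𝒢 0) :
    diracOp h𝒢 γ hA * scalarOp 𝒢 z = scalarOp 𝒢 z * diracOp h𝒢 γ hA :=
  abstractDirac_commute (fun μ => gammaOp N 𝒢 (γ μ)) (nablaOp h𝒢 hA) (z := scalarOp (N := N) 𝒢 z)
    (fun _ => gammaOp_commute_scalarOp _ z)
    (fun μ => nablaOp_commute_scalarOp h𝒢 hA μ z)

end SpinorOperators

/-! ### Heat coefficients as operators of order zero, and their traces -/

section HeatTrace

theorem one_add_mul_one_sub_of_sq_eq_zero {R : Type*} [Ring R] {w : R} (h : w * w = 0) :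
    (1 + w) * (1 - w) = 1 := by
  rw [add_mul, one_mul, mul_sub, mul_one, h]; abel

theorem one_sub_mul_one_add_of_sq_eq_zero {R : Type*} [Ring R] {w : R} (h : w * w = 0) :
    (1 - w) * (1 + w) = 1 := by
  rw [sub_mul, one_mul, mul_add, mul_one, h]; abel

variable {N : ℕ} {G : Type*} [NormedRing G] [NormedAlgebra ℂ G]
  {𝒢 : ZMod 2 → Submodule ℂ G} [GradedAlgebra 𝒢]

theorem symInt_symLin_apply (ξ : E4) (nab : Fin 4 → Module.End ℂ (evenSpinor N 𝒢))
    (ψ : evenSpinor N 𝒢) (x : E4) (i : Fin 4 × Fin N) :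
    (symInt (polyEval ξ).toLinearMap (symLin nab) ψ).1 x i =
      ∑ μ, (2 * Complex.I * (ξ μ : ℂ)) • (nab μ ψ).1 x i := by
  rw [symLin, map_sum, LinearMap.sum_apply, evenSpinor_sum_apply]
  refine Finset.sum_congr rfl fun μ _ => ?_
  rw [symInt_tmul, smul_smul]
  simp [polyEval, mul_comm]

theorem symbolPower_eq (h𝒢 : IsSupercommutative 𝒢) (γ : Fin 4 → Matrix (Fin 4) (Fin 4) ℂ)
    {A : Fin 4 → MatField N G} (hA : ∀ μ, IsEvenField 𝒢 (A μ)) (ξ : E4) (n m : ℕ)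
    (ψ : evenSpinor N 𝒢) :
    symbolPower γ A ξ n m ψ.1 = (symInt (polyEval ξ).toLinearMap
      (symPow (nablaOp h𝒢 hA) (diracOp h𝒢 γ hA * diracOp h𝒢 γ hA) n m) ψ).1 := by
  induction n generalizing m with
  | zero =>
    by_cases h : m = 0
    · simp [symbolPower, symPow, h, Algebra.TensorProduct.one_def]
    · simp [symbolPower, symPow, h]
  | succ n ih =>
    match m with
    | 0 => simp [symbolPower, symPow]
    | 1 =>
      rw [symPow, symInt_algHom_mul, symbolPower, ih]
      funext x i
      exact (symInt_symLin_apply ξ (nablaOp h𝒢 hA) (symInt (polyEval ξ).toLinearMap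
        (symPow (nablaOp h𝒢 hA) (diracOp h𝒢 γ hA * diracOp h𝒢 γ hA) n 0) ψ) x i).symm
    | m + 2 =>
      rw [symPow, map_sub, symInt_algHom_mul, symInt_algHom_mul, symbolPower, ih, ih]
      funext x i
      rw [LinearMap.sub_apply]
      refine congrArg₂ (· - ·) (symInt_symLin_apply ξ (nablaOp h𝒢 hA)
        (symInt (polyEval ξ).toLinearMap (symPow (nablaOp h𝒢 hA)
          (diracOp h𝒢 γ hA * diracOp h𝒢 γ hA) n (m + 1)) ψ) x i).symm ?_
      rw [symInt_tmul, ← diracOp_apply h𝒢 γ hA, ← diracOp_apply h𝒢 γ hA]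
      simp

/-- Integrability is part of the conclusion because additivity of the integral in the inductive step
needs it. -/
theorem integral_gaussian_symInt [CompleteSpace G] (w : PolySymbol (Module.End ℂ (evenSpinor N 𝒢)))
    (ψ : evenSpinor N 𝒢) (x : E4) (i : Fin 4 × Fin N) :
    Integrable (fun ξ : E4 =>
        Real.exp (-‖ξ‖ ^ 2) • (symInt (polyEval ξ).toLinearMap w ψ).1 x i) ∧
      ∫ ξ : E4, Real.exp (-‖ξ‖ ^ 2) • (symInt (polyEval ξ).toLinearMap w ψ).1 x i =
        (symInt gaussInt w ψ).1 x i := by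
  induction w using TensorProduct.induction_on with
  | zero => simp
  | add a b ha hb =>
    have h : ∀ ξ : E4, Real.exp (-‖ξ‖ ^ 2) •
        (symInt (polyEval ξ).toLinearMap (a + b) ψ).1 x i =
        Real.exp (-‖ξ‖ ^ 2) • (symInt (polyEval ξ).toLinearMap a ψ).1 x i +
          Real.exp (-‖ξ‖ ^ 2) • (symInt (polyEval ξ).toLinearMap b ψ).1 x i := by
      intro ξ
      rw [← smul_add, map_add]; rfl
    simp only [h]
    refine ⟨ha.1.add hb.1, ?_⟩
    rw [integral_add ha.1 hb.1, ha.2, hb.2, map_add]; rfl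
  | tmul p r =>
    have h : ∀ ξ : E4, Real.exp (-‖ξ‖ ^ 2) •
        (symInt (polyEval ξ).toLinearMap (p ⊗ₜ r) ψ).1 x i =
        ((Real.exp (-‖ξ‖ ^ 2) : ℂ) * polyEval ξ p) • (r ψ).1 x i := by
      intro ξ
      rw [symInt_tmul, mul_smul, Complex.coe_smul]; rfl
    simp only [h]
    refine ⟨(integrable_gaussian_mul_polyEval p).smul_const _, ?_⟩
    rw [integral_smul_const, symInt_tmul]; rfl

variable (N 𝒢) in
/-- The constant spinor fields of the standard basis. -/
def basisSpinor (i : Fin 4 × Fin N) : evenSpinor N 𝒢 :=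
  ⟨fun _ => Pi.single i 1, fun j => ⟨contDiff_const, fun _ => by
    by_cases h : j = i
    · subst h; simpa using one_mem_even
    · simp [h]⟩⟩

/-- The trace over spinor and colour indices of an operator of order zero, at the point `x`. -/
def fibreTrace (x : E4) (P : Module.End ℂ (evenSpinor N 𝒢)) : G :=
  ∑ i, (P (basisSpinor N 𝒢 i)).1 x i

theorem seeleyDeWitt_eq_fibreTrace [CompleteSpace G] (h𝒢 : IsSupercommutative 𝒢)
    (γ : Fin 4 → Matrix (Fin 4) (Fin 4) ℂ)
    {A : Fin 4 → MatField N G} (hA : ∀ μ, IsEvenField 𝒢 (A μ)) (m : ℕ) (x : E4) :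
    seeleyDeWitt γ A m x = ((2 * Real.pi) ^ 4)⁻¹ • fibreTrace x
      (heatOp (nablaOp h𝒢 hA) (diracOp h𝒢 γ hA * diracOp h𝒢 γ hA) gaussInt m) := by
  rw [seeleyDeWitt, fibreTrace]
  congr 1
  have h : ∀ (n : ℕ) (ξ : E4) (i : Fin 4 × Fin N),
      symbolPower γ A ξ n m (fun _ => Pi.single i 1) x i = (symInt (polyEval ξ).toLinearMap
        (symPow (nablaOp h𝒢 hA) (diracOp h𝒢 γ hA * diracOp h𝒢 γ hA) n m)
          (basisSpinor N 𝒢 i)).1 x i := fun n ξ i => by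
    rw [← symbolPower_eq]; rfl
  simp only [h, Finset.smul_sum]
  have h2 : ∀ n : ℕ, ∫ ξ : E4, ∑ i, Real.exp (-‖ξ‖ ^ 2) • (symInt (polyEval ξ).toLinearMap
        (symPow (nablaOp h𝒢 hA) (diracOp h𝒢 γ hA * diracOp h𝒢 γ hA) n m)
          (basisSpinor N 𝒢 i)).1 x i = ∑ i, (symInt gaussInt
        (symPow (nablaOp h𝒢 hA) (diracOp h𝒢 γ hA * diracOp h𝒢 γ hA) n m)
          (basisSpinor N 𝒢 i)).1 x i := fun n => by
    rw [integral_finsetSum _ fun i _ => (integral_gaussian_symInt _ _ x i).1]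
    exact Finset.sum_congr rfl fun i _ => (integral_gaussian_symInt _ _ x i).2
  simp only [h2, Finset.smul_sum]
  rw [Finset.sum_comm]
  refine Finset.sum_congr rfl fun i _ => ?_
  rw [heatOp, LinearMap.sum_apply, evenSpinor_sum_apply]
  refine Finset.sum_congr rfl fun n _ => ?_
  rw [← Complex.coe_smul]
  push_cast
  rfl

/-- Operators of order zero: they commute with coordinates and with even constants. -/
structure IsTensorial (P : Module.End ℂ (evenSpinor N 𝒢)) : Prop where
  coord : ∀ μ, P * coordOp N 𝒢 μ = coordOp N 𝒢 μ * P
  scalar : ∀ z, P * scalarOp 𝒢 z = scalarOp 𝒢 z * P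

theorem IsTensorial.mul {P Q : Module.End ℂ (evenSpinor N 𝒢)} (hP : IsTensorial P)
    (hQ : IsTensorial Q) : IsTensorial (P * Q) where
  coord μ := Commute.mul_left (hP.coord μ) (hQ.coord μ)
  scalar z := Commute.mul_left (hP.scalar z) (hQ.scalar z)

theorem IsTensorial.one : IsTensorial (1 : Module.End ℂ (evenSpinor N 𝒢)) where
  coord _ := Commute.one_left _
  scalar _ := Commute.one_left _

theorem IsTensorial.add {P Q : Module.End ℂ (evenSpinor N 𝒢)} (hP : IsTensorial P)
    (hQ : IsTensorial Q) : IsTensorial (P + Q) where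
  coord μ := Commute.add_left (hP.coord μ) (hQ.coord μ)
  scalar z := Commute.add_left (hP.scalar z) (hQ.scalar z)

theorem IsTensorial.sub {P Q : Module.End ℂ (evenSpinor N 𝒢)} (hP : IsTensorial P)
    (hQ : IsTensorial Q) : IsTensorial (P - Q) where
  coord μ := Commute.sub_left (R := Module.End ℂ (evenSpinor N 𝒢)) (hP.coord μ) (hQ.coord μ)
  scalar z := Commute.sub_left (R := Module.End ℂ (evenSpinor N 𝒢)) (hP.scalar z) (hQ.scalar z)

theorem isTensorial_matOp (h𝒢 : IsSupercommutative 𝒢) {B : MatField N G}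
    (hB : IsEvenField 𝒢 B) : IsTensorial (matOp hB) :=
  ⟨matOp_commute_coordOp hB, matOp_commute_scalarOp h𝒢 hB⟩

theorem isTensorial_heatOp (h𝒢 : IsSupercommutative 𝒢)
    {γ : Fin 4 → Matrix (Fin 4) (Fin 4) ℂ} (hγ : IsGamma γ)
    {A : Fin 4 → MatField N G} (hA : ∀ μ, IsEvenField 𝒢 (A μ)) (m : ℕ) :
    IsTensorial (heatOp (nablaOp h𝒢 hA) (diracOp h𝒢 γ hA * diracOp h𝒢 γ hA) gaussInt m) where
  coord μ := heatOp_commute (nablaOp h𝒢 hA) (coordOp N 𝒢) _ gaussInt gaussInt_pderiv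
    (nablaOp_comm_coordOp h𝒢 hA) (diracOp_sq_comm_coordOp h𝒢 hγ hA) m μ
  scalar z := heatOp_commute_of_commute gaussInt (fun μ => nablaOp_commute_scalarOp h𝒢 hA μ z)
    (by rw [mul_assoc, diracOp_commute_scalarOp, ← mul_assoc, diracOp_commute_scalarOp,
      mul_assoc]) m

/-- By Hadamard's lemma `ψ` is the constant spinor `ψ(x)` plus terms `(y_μ - x_μ) φ_μ`. Since `P`
commutes with coordinates, the latter contribute zero at `x`; since it commutes with even constants,
the former is determined by the basis spinors. -/
theorem IsTensorial.apply_eq [CompleteSpace G] (h𝒢 : IsSupercommutative 𝒢)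
    {P : Module.End ℂ (evenSpinor N 𝒢)} (hP : IsTensorial P) (ψ : evenSpinor N 𝒢) (x : E4)
    (i : Fin 4 × Fin N) :
    (P ψ).1 x i = ∑ j, ψ.1 x j * (P (basisSpinor N 𝒢 j)).1 x i := by
  choose h hs hm he using fun j => hadamard_lemma ((𝒢 0).restrictScalars ℝ) (h𝒢.isClosed 0)
    (ψ.2 j).1 (ψ.2 j).2 x
  let φ : Fin 4 → evenSpinor N 𝒢 := fun μ => ⟨fun y j => h j μ y, fun j => ⟨hs j μ, hm j μ⟩⟩
  have e : ψ = ∑ j, scalarOp 𝒢 ⟨ψ.1 x j, (ψ.2 j).2 x⟩ (basisSpinor N 𝒢 j) +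
      ∑ μ, (coordOp N 𝒢 μ (φ μ) - ((x μ : ℝ) : ℂ) • φ μ) := by
    ext y k
    change ψ.1 y k = (∑ j, scalarOp 𝒢 ⟨ψ.1 x j, (ψ.2 j).2 x⟩ (basisSpinor N 𝒢 j)).1 y k +
      (∑ μ, (coordOp N 𝒢 μ (φ μ) - ((x μ : ℝ) : ℂ) • φ μ)).1 y k
    rw [evenSpinor_sum_apply, evenSpinor_sum_apply, he k y]
    congr 1
    · change _ = ∑ j, ψ.1 x j * (Pi.single j (1 : G) : Fin 4 × Fin N → G) k
      simp [Pi.single_apply]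
    · refine Finset.sum_congr rfl fun μ _ => ?_
      change _ = y μ • h k μ y - ((x μ : ℝ) : ℂ) • h k μ y
      rw [Complex.coe_smul, sub_smul]
  have h1 : ∀ μ, (P (coordOp N 𝒢 μ (φ μ) - ((x μ : ℝ) : ℂ) • φ μ)).1 x i = 0 := fun μ => by
    rw [map_sub, map_smul]
    have := congrArg (fun T => (T (φ μ)).1 x i) (hP.coord μ)
    change (P (coordOp N 𝒢 μ (φ μ))).1 x i - ((x μ : ℝ) : ℂ) • (P (φ μ)).1 x i = 0
    rw [Complex.coe_smul, sub_eq_zero]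
    exact this
  conv_lhs => rw [e]
  rw [map_add, map_sum, map_sum]
  change (∑ j, P (scalarOp 𝒢 ⟨ψ.1 x j, (ψ.2 j).2 x⟩ (basisSpinor N 𝒢 j))).1 x i +
    (∑ μ, P (coordOp N 𝒢 μ (φ μ) - ((x μ : ℝ) : ℂ) • φ μ)).1 x i = _
  rw [evenSpinor_sum_apply, evenSpinor_sum_apply, Finset.sum_congr rfl fun μ _ => h1 μ,
    Finset.sum_const_zero, add_zero]
  refine Finset.sum_congr rfl fun j _ => ?_
  exact congrArg (fun T => (T (basisSpinor N 𝒢 j)).1 x i) (hP.scalar ⟨ψ.1 x j, (ψ.2 j).2 x⟩)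

/-- At `x` both operators are matrices with entries in the commutative even part, so the usual trace
argument applies. -/
theorem fibreTrace_mul_comm [CompleteSpace G] (h𝒢 : IsSupercommutative 𝒢)
    {P Q : Module.End ℂ (evenSpinor N 𝒢)} (hP : IsTensorial P) (hQ : IsTensorial Q) (x : E4) :
    fibreTrace x (P * Q) = fibreTrace x (Q * P) := by
  simp only [fibreTrace, Module.End.mul_apply]
  simp only [fun i => hP.apply_eq h𝒢 (Q (basisSpinor N 𝒢 i)) x i,
    fun i => hQ.apply_eq h𝒢 (P (basisSpinor N 𝒢 i)) x i]
  rw [Finset.sum_comm]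
  refine Finset.sum_congr rfl fun i _ => Finset.sum_congr rfl fun j _ => ?_
  exact h𝒢.even_comm _ ((Q (basisSpinor N 𝒢 j)).2 i |>.2 x) _

theorem pdOp_comm_matOp (h𝒢 : IsSupercommutative 𝒢) {B : MatField N G} (hB : IsEvenField 𝒢 B)
    (μ : Fin 4) (hB' : IsEvenField 𝒢 (pd μ B)) :
    pdOp h𝒢 μ * matOp hB = matOp hB * pdOp h𝒢 μ + matOp hB' := by
  ext ψ x i
  change fderiv ℝ (fun y => ∑ b, B y i.2 b * ψ.1 y (i.1, b)) x (frame μ) =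
    ∑ b, B x i.2 b * fderiv ℝ (fun y => ψ.1 y (i.1, b)) x (frame μ) +
      ∑ b, fderiv ℝ (fun y => B y i.2 b) x (frame μ) * ψ.1 x (i.1, b)
  have h : HasFDerivAt (fun y => ∑ b, B y i.2 b * ψ.1 y (i.1, b)) _ x :=
    HasFDerivAt.fun_sum fun b _ => ((hB.smooth i.2 b).differentiable (by simp) x).hasFDerivAt.mul'
      ((ψ.2 (i.1, b)).1.differentiable (by simp) x).hasFDerivAt
  rw [h.fderiv, _root_.sum_apply, ← Finset.sum_add_distrib]
  rfl

theorem matOp_mul {B C : MatField N G} (hB : IsEvenField 𝒢 B) (hC : IsEvenField 𝒢 C)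
    (hBC : IsEvenField 𝒢 (fun x => B x * C x)) : matOp hB * matOp hC = matOp hBC := by
  ext ψ x i
  change ∑ b, B x i.2 b * ∑ c, C x b c * ψ.1 x (i.1, c) =
    ∑ c, (B x * C x) i.2 c * ψ.1 x (i.1, c)
  simp only [Finset.mul_sum, Matrix.mul_apply, Finset.sum_mul, ← mul_assoc]
  exact Finset.sum_comm

/-- The Seeley–De Witt invariants agree for connections that are conjugate under `1 + w` with
`w` square-zero. -/
theorem seeleyDeWitt_congr_of_conj [CompleteSpace G] (h𝒢 : IsSupercommutative 𝒢)
    {γ : Fin 4 → Matrix (Fin 4) (Fin 4) ℂ} (hγ : IsGamma γ)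
    {A A' : Fin 4 → MatField N G} (hA : ∀ μ, IsEvenField 𝒢 (A μ))
    (hA' : ∀ μ, IsEvenField 𝒢 (A' μ)) {w : MatField N G} (hw : IsEvenField 𝒢 w)
    (hsq : matOp hw * matOp hw = 0)
    (hconj : ∀ μ, nablaOp h𝒢 hA' μ = (1 - matOp hw) * (nablaOp h𝒢 hA μ * (1 + matOp hw)))
    (m : ℕ) (x : E4) : seeleyDeWitt γ A' m x = seeleyDeWitt γ A m x := by
  have huv : (1 + matOp hw) * (1 - matOp hw) = 1 :=
    one_add_mul_one_sub_of_sq_eq_zero (R := Module.End ℂ (evenSpinor N 𝒢)) hsq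
  have hvu : (1 - matOp hw) * (1 + matOp hw) = 1 :=
    one_sub_mul_one_add_of_sq_eq_zero (R := Module.End ℂ (evenSpinor N 𝒢)) hsq
  set f := conjAlgHom (R := Module.End ℂ (evenSpinor N 𝒢)) _ _ huv hvu with hf
  have hn : nablaOp h𝒢 hA' = fun μ => f (nablaOp h𝒢 hA μ) := by
    funext μ; rw [hconj, hf, conjAlgHom_apply]
  -- Gamma matrices act on the spinor index and `w` on the colour index, so the conjugation that
  -- transforms `∇` also transforms the Dirac operator.
  have hg : ∀ g, f (gammaOp N 𝒢 g) = gammaOp N 𝒢 g := fun g => by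
    have h1 : gammaOp N 𝒢 g * (1 + matOp hw) = (1 + matOp hw) * gammaOp N 𝒢 g :=
      Commute.add_right (Commute.one_right _) (gammaOp_commute_matOp hw g)
    rw [hf, conjAlgHom_apply, h1, ← mul_assoc, hvu, one_mul]
  have hd : diracOp h𝒢 γ hA' = f (diracOp h𝒢 γ hA) := by
    simp only [diracOp, map_sum, map_smul, map_mul, hg, hn]
  have hT := isTensorial_matOp h𝒢 hw
  have hH := heatOp_map (R := Module.End ℂ (evenSpinor N 𝒢))
    (S := Module.End ℂ (evenSpinor N 𝒢)) f (nablaOp h𝒢 hA)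
    (diracOp h𝒢 γ hA * diracOp h𝒢 γ hA) gaussInt m
  -- The trace of `(1 - w) H (1 + w)` equals that of `H (1 + w)(1 - w) = H`; cyclicity is legitimate
  -- because `H` and `w` have order zero.
  rw [seeleyDeWitt_eq_fibreTrace h𝒢 γ hA, seeleyDeWitt_eq_fibreTrace h𝒢 γ hA', hd, hn,
    ← map_mul, hH, hf, conjAlgHom_apply, fibreTrace_mul_comm h𝒢
      (IsTensorial.one.sub hT) ((isTensorial_heatOp h𝒢 hγ hA m).mul (IsTensorial.one.add hT)),
    mul_assoc, huv, mul_one]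

end HeatTrace

/-! ### Deck transformations, partitions of unity and the divergence theorem on `E4 / Γ` -/

section Deck

variable {Γ : Type*} [Group Γ] [MulAction Γ E4] [IsIsometricSMul Γ E4]

/-- The linear part of a deck transformation. -/
def deckLin (s : Γ) : E4 ≃ₗᵢ[ℝ] E4 :=
  (IsometryEquiv.constSMul (X := E4) s).toRealAffineIsometryEquiv.linearIsometryEquiv

/-- An isometry of Euclidean space is affine (Mazur–Ulam). This makes the action smooth, with
constant orthogonal Jacobian. -/
theorem smul_eq_deckLin_add (s : Γ) (x : E4) : s • x = deckLin s x + s • (0 : E4) := by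
  have := (IsometryEquiv.constSMul (X := E4) s).toRealAffineIsometryEquiv.map_vadd 0 x
  simpa [deckLin] using this

theorem hasFDerivAt_deck (s : Γ) (x : E4) :
    HasFDerivAt (fun y : E4 => s • y) ((deckLin s).toContinuousLinearEquiv : E4 →L[ℝ] E4) x := by
  have h : (fun y : E4 => s • y) = fun y => deckLin s y + s • (0 : E4) :=
    funext (smul_eq_deckLin_add s)
  rw [h]
  exact ((deckLin s).toContinuousLinearEquiv.hasFDerivAt).add_const _

theorem contDiff_deck (s : Γ) : ContDiff ℝ ∞ fun y : E4 => s • y := by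
  have h : (fun y : E4 => s • y) = fun y => deckLin s y + s • (0 : E4) :=
    funext (smul_eq_deckLin_add s)
  rw [h]
  exact (deckLin s).contDiff.add contDiff_const

/-- The matrix of a deck transformation: `deckMat s μ ν` is the `ν`-component of the image of the
frame vector `μ`. -/
def deckMat (s : Γ) (μ ν : Fin 4) : ℝ := deckLin s (frame μ) ν

theorem fderiv_deck_apply (s : Γ) (x : E4) (μ ν : Fin 4) :
    (fderiv ℝ (fun y : E4 => s • y) x (frame μ)) ν = deckMat s μ ν := by
  rw [(hasFDerivAt_deck s x).fderiv]; rfl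

theorem deckLin_frame (s : Γ) (μ : Fin 4) : deckLin s (frame μ) = ∑ ν, deckMat s μ ν • frame ν := by
  ext κ
  simp [deckMat, frame, Pi.single_apply]

theorem deckMat_sum_left (s : Γ) (ν κ : Fin 4) :
    ∑ μ, deckMat s μ ν * deckMat s μ κ = if ν = κ then 1 else 0 := by
  have h := ((EuclideanSpace.basisFun (Fin 4) ℝ).map (deckLin s)).sum_inner_mul_inner
    (frame ν) (frame κ)
  simp only [OrthonormalBasis.map_apply, EuclideanSpace.basisFun_apply] at h
  simp only [frame, EuclideanSpace.inner_single_left, EuclideanSpace.inner_single_right, map_one,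
    one_mul] at h
  simp only [deckMat, frame]
  convert h using 1
  · simp
  · rcases eq_or_ne ν κ with rfl | hne
    · simp
    · simp [hne, hne.symm]

theorem deckMat_sum_right (s : Γ) (μ κ : Fin 4) :
    ∑ ν, deckMat s μ ν * deckMat s κ ν = if μ = κ then 1 else 0 := by
  have h := (deckLin s).inner_map_map (frame μ) (frame κ)
  rw [PiLp.inner_apply] at h
  simp only [frame, EuclideanSpace.inner_single_left, map_one, one_mul] at h
  simp only [deckMat, frame]
  convert h using 1
  · simp [mul_comm]
  · rcases eq_or_ne μ κ with rfl | hne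
    · simp
    · simp [hne]

theorem sum_deckMat_smul_sum {W : Type*} [AddCommGroup W] [Module ℝ W] (s : Γ) (v : Fin 4 → W)
    (ν : Fin 4) : ∑ μ, deckMat s μ ν • ∑ κ, deckMat s μ κ • v κ = v ν := by
  simp only [Finset.smul_sum, smul_smul]
  rw [Finset.sum_comm]
  simp only [← Finset.sum_smul, deckMat_sum_left, ite_smul, one_smul, zero_smul]
  simp

theorem fderiv_comp_deck {W : Type*} [NormedAddCommGroup W] [NormedSpace ℝ W] {f : E4 → W}
    (hf : ContDiff ℝ ∞ f) (s : Γ) (x : E4) (μ : Fin 4) :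
    fderiv ℝ (fun y => f (s • y)) x (frame μ) =
      ∑ ν, deckMat s μ ν • fderiv ℝ f (s • x) (frame ν) := by
  have h := ((hf.differentiable (by simp)) (s • x)).hasFDerivAt.comp x (hasFDerivAt_deck s x)
  have h' : fderiv ℝ (fun y => f (s • y)) x = _ := h.fderiv
  rw [h', ContinuousLinearMap.comp_apply]
  change fderiv ℝ f (s • x) (deckLin s (frame μ)) = _
  rw [deckLin_frame, map_sum]
  simp only [map_smul]

instance : SMulInvariantMeasure Γ E4 volume where
  measure_preimage_smul s t ht := by
    have h : (fun y : E4 => s • y) = (fun y => y + s • (0 : E4)) ∘ deckLin s :=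
      funext (smul_eq_deckLin_add s)
    rw [h]
    exact ((measurePreserving_add_right volume _).comp
      (deckLin s).measurePreserving).measure_preimage ht.nullMeasurableSet

variable [ProperlyDiscontinuousSMul Γ E4]

theorem finite_deck (K L : Set E4) (hK : IsCompact K) (hL : IsCompact L) :
    {s : Γ | ∃ x ∈ K, s • x ∈ L}.Finite := by
  refine (ProperlyDiscontinuousSMul.finite_disjoint_inter_image (Γ := Γ) hK hL).subset ?_
  rintro s ⟨x, hx, hs⟩
  have h : (((s • ·) '' K) ∩ L).Nonempty := ⟨s • x, ⟨x, hx, rfl⟩, hs⟩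
  exact h

variable (Γ) in
theorem countable_deck : Countable Γ := by
  have h : (Set.univ : Set Γ) = ⋃ n : ℕ, {s : Γ | ∃ x ∈ ({0} : Set E4),
      s • x ∈ Metric.closedBall (0 : E4) n} := by
    refine (Set.eq_univ_of_forall fun s => ?_).symm
    obtain ⟨n, hn⟩ := exists_nat_ge ‖s • (0 : E4)‖
    exact Set.mem_iUnion.2 ⟨n, 0, rfl, by simpa using hn⟩
  rw [← Set.countable_univ_iff, h]
  exact Set.countable_iUnion fun n =>
    (finite_deck _ _ isCompact_singleton (isCompact_closedBall _ _)).countable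

theorem finite_support_deck {W : Type*} [Zero W] {f : E4 → W} (hf : HasCompactSupport f) (x : E4) :
    (Function.support fun s : Γ => f (s • x)).Finite :=
  (finite_deck {x} _ isCompact_singleton hf).subset fun _ hs =>
    ⟨x, rfl, subset_tsupport _ hs⟩

/-- Near a point, only finitely many translates of a compactly supported function matter. -/
theorem exists_finset_deck {W : Type*} [Zero W] {f : E4 → W} (hf : HasCompactSupport f) (x : E4) :
    ∃ S : Finset Γ, ∀ s ∉ S, ∀ y ∈ Metric.closedBall x 1, f (s • y) = 0 := by
  refine ⟨(finite_deck _ _ (isCompact_closedBall x 1) hf).toFinset, fun s hs y hy => ?_⟩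
  by_contra h
  exact hs ((Set.Finite.mem_toFinset _).2 ⟨y, hy, subset_tsupport _ h⟩)

theorem contDiff_finsum_deck {W : Type*} [NormedAddCommGroup W] [NormedSpace ℝ W] {f : E4 → W}
    (hs : HasCompactSupport f) (hf : ContDiff ℝ ∞ f) :
    ContDiff ℝ ∞ fun x => ∑ᶠ s : Γ, f (s • x) := by
  refine contDiff_iff_contDiffAt.2 fun x => ?_
  obtain ⟨S, hS⟩ := exists_finset_deck (Γ := Γ) hs x
  have h : ContDiff ℝ ∞ fun y => ∑ s ∈ S, f (s • y) :=
    ContDiff.sum fun s _ => hf.comp (contDiff_deck s)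
  refine h.contDiffAt.congr_of_eventuallyEq ?_
  filter_upwards [Metric.closedBall_mem_nhds x one_pos] with y hy
  refine finsum_eq_sum_of_support_subset _ fun s hs => ?_
  by_contra hn
  exact hs (hS s hn y hy)

variable [CompactSpace (MulAction.orbitRel.Quotient Γ E4)]

variable (Γ) in
-- The quotient map is open, so the images of the balls around `0` form an open cover of the compact
-- quotient.
theorem exists_radius_deck : ∃ R : ℕ, ∀ x : E4, ∃ s : Γ, s • x ∈ Metric.ball (0 : E4) R := by
  let q : E4 → MulAction.orbitRel.Quotient Γ E4 := Quotient.mk _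
  have hq : IsOpenMap q := isOpenMap_quotient_mk'_mul
  obtain ⟨t, ht⟩ := isCompact_univ.elim_finite_subcover (fun n : ℕ => q '' Metric.ball 0 n)
    (fun n => hq _ Metric.isOpen_ball) (by
      rintro y -
      obtain ⟨x, rfl⟩ := Quotient.exists_rep y
      obtain ⟨n, hn⟩ := exists_nat_gt ‖x‖
      exact Set.mem_iUnion.2 ⟨n, x, by simpa using hn, rfl⟩)
  refine ⟨t.sup id, fun x => ?_⟩
  obtain ⟨n, hn, y, hy, hxy⟩ := Set.mem_iUnion₂.1 (ht (Set.mem_univ (q x)))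
  obtain ⟨s, hs⟩ := Quotient.exact hxy
  refine ⟨s, ?_⟩
  have hs' : s • x = y := hs
  rw [hs']
  refine Metric.ball_subset_ball ?_ hy
  exact_mod_cast Finset.le_sup (f := id) hn

variable (Γ) in
-- Divide a bump function equal to one on a ball meeting every orbit by the sum of its translates,
-- which is positive, smooth and `Γ`-invariant.
theorem exists_deck_partition : ∃ φ : E4 → ℝ, ContDiff ℝ ∞ φ ∧ HasCompactSupport φ ∧
    ∀ x, ∑ᶠ s : Γ, φ (s • x) = 1 := by
  obtain ⟨R, hR⟩ := exists_radius_deck Γ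
  let χ : ContDiffBump (0 : E4) := ⟨R + 1, R + 2, by positivity, by linarith⟩
  have hχ : ContDiff ℝ ∞ χ := χ.contDiff
  have hχc : HasCompactSupport χ := χ.hasCompactSupport
  let h : E4 → ℝ := fun x => ∑ᶠ s : Γ, χ (s • x)
  have hh : ContDiff ℝ ∞ h := contDiff_finsum_deck hχc hχ
  have hpos : ∀ x, 0 < h x := fun x => by
    obtain ⟨s, hs⟩ := hR x
    have h1 : χ (s • x) = 1 := χ.one_of_mem_closedBall
      (Metric.ball_subset_closedBall (Metric.ball_subset_ball (by simp [χ]) hs))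
    have h2 : χ (s • x) ≤ h x :=
      single_le_finsum s (finite_support_deck hχc x) fun t => χ.nonneg
    linarith
  have hinv : ∀ (t : Γ) x, h (t • x) = h x := fun t x => by
    have := finsum_comp_equiv (Equiv.mulRight t) (f := fun s : Γ => χ (s • x))
    simpa [h, mul_smul] using this
  refine ⟨fun x => χ x * (h x)⁻¹, hχ.mul (hh.inv fun x => (hpos x).ne'), hχc.mul_right,
    fun x => ?_⟩
  simp only [hinv]
  rw [← finsum_mul]
  exact mul_inv_cancel₀ (hpos x).ne'

variable {F : Set E4} {W : Type*} [NormedAddCommGroup W] [NormedSpace ℝ W]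

theorem integral_eq_setIntegral_tsum_deck (hF : IsFundamentalDomain Γ F volume)
    {f : E4 → W} (hf : Integrable f) :
    ∫ x, f x = ∫ x in F, ∑' s : Γ, f (s • x) := by
  have := countable_deck Γ
  rw [hF.integral_eq_tsum'' f hf, integral_tsum]
  · intro s
    exact ((measurePreserving_smul s volume).integrable_comp_of_integrable
      hf).aestronglyMeasurable.restrict
  · have := hF.lintegral_eq_tsum'' fun x => ‖f x‖ₑ
    rw [← this]
    exact hf.2.ne

/-- `F` is an arbitrary measurable fundamental domain and may be unbounded, so continuity alone does
not suffice. Bounding `|f|` by the sum of the translates of `|φ f|` and unfolding compares the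
integral with that of a compactly supported function on `E4`. -/
theorem integrableOn_of_invariant (hF : IsFundamentalDomain Γ F volume)
    {f : E4 → W} (hf : Continuous f)
    (hinv : ∀ (s : Γ) x, f (s • x) = f x) : IntegrableOn f F := by
  have := countable_deck Γ
  obtain ⟨φ, hφ, hφc, hφ1⟩ := exists_deck_partition Γ
  have hg : Integrable fun x => φ x • f x :=
    (hφ.continuous.smul hf).integrable_of_hasCompactSupport hφc.smul_right
  refine ⟨hf.aestronglyMeasurable, ?_⟩
  have h1 : ∀ x, ‖f x‖ₑ ≤ ∑' s : Γ, ‖φ (s • x) • f (s • x)‖ₑ := by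
    intro x
    have hfin := finite_support_deck (Γ := Γ) hφc x
    have h2 : f x = ∑ s ∈ hfin.toFinset, φ (s • x) • f (s • x) := by
      simp only [hinv, ← Finset.sum_smul]
      rw [← finsum_eq_sum _ hfin, hφ1, one_smul]
    conv_lhs => rw [h2]
    exact (enorm_sum_le _ _).trans (ENNReal.sum_le_tsum _)
  calc ∫⁻ x in F, ‖f x‖ₑ ≤ ∫⁻ x in F, ∑' s : Γ, ‖φ (s • x) • f (s • x)‖ₑ :=
        lintegral_mono h1
    _ = ∑' s : Γ, ∫⁻ x in F, ‖φ (s • x) • f (s • x)‖ₑ := by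
        refine lintegral_tsum fun s => ?_
        have hc : Continuous fun x : E4 => ‖φ (s • x) • f (s • x)‖ₑ :=
          ((hφ.continuous.smul hf).comp (continuous_const_smul s)).enorm
        exact hc.aemeasurable
    _ = ∫⁻ x, ‖φ x • f x‖ₑ := (hF.lintegral_eq_tsum'' fun x => ‖φ x • f x‖ₑ).symm
    _ < ⊤ := hg.2

/-- The divergence theorem on the closed flat manifold `E4 / Γ`. -/
theorem setIntegral_divergence_eq_zero [CompleteSpace W] (hF : IsFundamentalDomain Γ F volume)
    {V : Fin 4 → E4 → W}
    (hV : ∀ μ, ContDiff ℝ ∞ (V μ))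
    (hinv : ∀ (s : Γ) x μ, ∑ ν, deckMat s μ ν • V ν (s • x) = V μ x)
    (hdiv : ∀ (s : Γ) x, ∑ μ, fderiv ℝ (V μ) (s • x) (frame μ) =
      ∑ μ, fderiv ℝ (V μ) x (frame μ)) :
    ∫ x in F, ∑ μ, fderiv ℝ (V μ) x (frame μ) = 0 := by
  obtain ⟨φ, hφ, hφc, hφ1⟩ := exists_deck_partition Γ
  have hVd : ∀ μ, ContDiff ℝ ∞ fun x => fderiv ℝ (V μ) x (frame μ) := fun μ =>
    contDiff_fderiv_apply (hV μ) _
  have hφd : ∀ μ, ContDiff ℝ ∞ fun x => fderiv ℝ φ x (frame μ) := fun μ =>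
    contDiff_fderiv_apply hφ _
  have hφdc : ∀ μ, HasCompactSupport fun x => fderiv ℝ φ x (frame μ) := fun μ =>
    hφc.fderiv_apply (𝕜 := ℝ) (frame μ)
  have hi1 : ∀ μ, Integrable fun x => φ x • fderiv ℝ (V μ) x (frame μ) := fun μ =>
    (hφ.continuous.smul (hVd μ).continuous).integrable_of_hasCompactSupport hφc.smul_right
  have hi2 : ∀ μ, Integrable fun x => fderiv ℝ φ x (frame μ) • V μ x := fun μ =>
    ((hφd μ).continuous.smul (hV μ).continuous).integrable_of_hasCompactSupport
      (hφdc μ).smul_right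
  have hi3 : ∀ μ, Integrable fun x => φ x • V μ x := fun μ =>
    (hφ.continuous.smul (hV μ).continuous).integrable_of_hasCompactSupport hφc.smul_right
  -- Inserting `φ` unfolds the integral over `F` to all of `E4`, where integration by parts has no
  -- boundary terms and moves the derivative onto `φ`.
  have h1 : ∫ x in F, ∑ μ, fderiv ℝ (V μ) x (frame μ) =
      ∫ x, ∑ μ, φ x • fderiv ℝ (V μ) x (frame μ) := by
    rw [integral_eq_setIntegral_tsum_deck hF (integrable_finsetSum _ fun μ _ => hi1 μ)]
    congr 1
    funext x
    simp only [← Finset.smul_sum, hdiv]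
    have hfin := finite_support_deck (Γ := Γ) hφc x
    rw [tsum_eq_sum (s := hfin.toFinset), ← Finset.sum_smul, ← finsum_eq_sum _ hfin, hφ1,
      one_smul]
    intro s hs
    have : φ (s • x) = 0 := by simpa using hs
    rw [this, zero_smul]
  have h2 : ∫ x, ∑ μ, φ x • fderiv ℝ (V μ) x (frame μ) =
      -∫ x, ∑ μ, fderiv ℝ φ x (frame μ) • V μ x := by
    rw [integral_finsetSum _ fun μ _ => hi1 μ, integral_finsetSum _ fun μ _ => hi2 μ,
      ← Finset.sum_neg_distrib]
    exact Finset.sum_congr rfl fun μ _ => integral_smul_fderiv_eq_neg_fderiv_smul_of_integrable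
      (hi2 μ) (hi1 μ) (hi3 μ) (fun x _ => hφ.differentiable (by simp) x)
      (fun x _ => (hV μ).differentiable (by simp) x)
  -- Folding back, invariance of `V` turns the sum over `Γ` into the derivative of the sum of the
  -- translates of `φ`, which is the constant one.
  have h3 : ∀ x, ∑' s : Γ, ∑ μ, fderiv ℝ φ (s • x) (frame μ) • V μ (s • x) = 0 := by
    intro x
    obtain ⟨S, hS⟩ := exists_finset_deck (Γ := Γ) hφc x
    have hx : ∀ᶠ y in nhds x, y ∈ Metric.closedBall x 1 := Metric.closedBall_mem_nhds x one_pos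
    have hV' : ∀ (s : Γ) ν, V ν (s • x) = ∑ μ, deckMat s μ ν • V μ x := fun s ν => by
      simp only [← hinv s x, sum_deckMat_smul_sum]
    have h4 : ∀ s : Γ, ∑ μ, fderiv ℝ φ (s • x) (frame μ) • V μ (s • x) =
        ∑ μ, fderiv ℝ (fun y => φ (s • y)) x (frame μ) • V μ x := fun s => by
      simp only [hV', fderiv_comp_deck hφ, Finset.sum_smul, Finset.smul_sum, smul_smul,
        smul_eq_mul]
      rw [Finset.sum_comm]
      simp only [mul_comm]
    rw [tsum_eq_sum (s := S)]
    · simp only [h4]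
      rw [Finset.sum_comm]
      refine Finset.sum_eq_zero fun μ _ => ?_
      rw [← Finset.sum_smul]
      have h5 : HasFDerivAt (fun y => ∑ s ∈ S, φ (s • y))
          (∑ s ∈ S, fderiv ℝ (fun y => φ (s • y)) x) x :=
        HasFDerivAt.fun_sum fun s _ =>
          ((hφ.comp (contDiff_deck s)).differentiable (by simp) x).hasFDerivAt
      have h6 : HasFDerivAt (fun y => ∑ s ∈ S, φ (s • y)) (0 : E4 →L[ℝ] ℝ) x := by
        refine (hasFDerivAt_const (1 : ℝ) x).congr_of_eventuallyEq ?_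
        filter_upwards [hx] with y hy
        rw [← hφ1 y]
        refine (finsum_eq_sum_of_support_subset _ fun s hs => ?_).symm
        by_contra hn
        exact hs (hS s hn y hy)
      have h7 := congrArg (fun T => T (frame μ)) (h5.unique h6)
      simp only [_root_.sum_apply, _root_.zero_apply] at h7
      rw [h7, zero_smul]
    · intro s hs
      rw [h4]
      refine Finset.sum_eq_zero fun μ _ => ?_
      have h8 : HasFDerivAt (fun y => φ (s • y)) (0 : E4 →L[ℝ] ℝ) x := by
        refine (hasFDerivAt_const (0 : ℝ) x).congr_of_eventuallyEq ?_
        filter_upwards [hx] with y hy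
        exact hS s hs y hy
      rw [h8.fderiv, _root_.zero_apply, zero_smul]
  rw [h1, h2, integral_eq_setIntegral_tsum_deck hF (integrable_finsetSum _ fun μ _ => hi2 μ)]
  simp only [h3, integral_zero, neg_zero]

end Deck

/-! ### Calculus of matrix fields with noncommuting entries -/

section MatCalculus

variable {N : ℕ} {G : Type*} [NormedRing G] [NormedAlgebra ℂ G]

/-- Matrix fields with smooth entries. -/
def SmoothMat (B : MatField N G) : Prop := ∀ a b, ContDiff ℝ ∞ fun x => B x a b

variable {B C : MatField N G}

theorem SmoothMat.hasFDerivAt (hB : SmoothMat B) (x : E4) (a b : Fin N) :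
    HasFDerivAt (fun y => B y a b) (fderiv ℝ (fun y => B y a b) x) x :=
  ((hB a b).differentiable (by simp) x).hasFDerivAt

theorem pd_eq_of_hasFDerivAt {μ : Fin 4} {x : E4} {D : Fin N → Fin N → E4 →L[ℝ] G}
    (h : ∀ a b, HasFDerivAt (fun y => B y a b) (D a b) x) :
    pd μ B x = Matrix.of fun a b => D a b (frame μ) := by
  ext a b
  simp only [pd, Matrix.of_apply, (h a b).fderiv]

theorem SmoothMat.const (M : Matrix (Fin N) (Fin N) G) : SmoothMat fun _ => M :=
  fun _ _ => contDiff_const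

theorem SmoothMat.add (hB : SmoothMat B) (hC : SmoothMat C) : SmoothMat fun x => B x + C x :=
  fun a b => (hB a b).add (hC a b)

theorem SmoothMat.sub (hB : SmoothMat B) (hC : SmoothMat C) : SmoothMat fun x => B x - C x :=
  fun a b => (hB a b).sub (hC a b)

theorem SmoothMat.neg (hB : SmoothMat B) : SmoothMat fun x => -B x := fun a b => (hB a b).neg

theorem SmoothMat.mul (hB : SmoothMat B) (hC : SmoothMat C) : SmoothMat fun x => B x * C x := by
  intro a b
  simp only [Matrix.mul_apply]
  exact ContDiff.sum fun c _ => (hB a c).mul (hC c b)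

theorem SmoothMat.real_smul (r : ℝ) (hB : SmoothMat B) : SmoothMat fun x => r • B x :=
  fun a b => (hB a b).const_smul r

theorem SmoothMat.left_smul (g : G) (hB : SmoothMat B) : SmoothMat fun x => g • B x :=
  fun a b => contDiff_const.mul (hB a b)

theorem SmoothMat.sum {ι : Type*} {s : Finset ι} {f : ι → MatField N G}
    (hf : ∀ i ∈ s, SmoothMat (f i)) : SmoothMat fun x => ∑ i ∈ s, f i x := by
  intro a b
  simp only [Matrix.sum_apply]
  exact ContDiff.sum fun i hi => hf i hi a b

theorem SmoothMat.pd (μ : Fin 4) (hB : SmoothMat B) : SmoothMat (pd μ B) :=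
  fun a b => contDiff_fderiv_apply (hB a b) _

theorem SmoothMat.lap (hB : SmoothMat B) : SmoothMat (lap B) :=
  (SmoothMat.sum fun μ _ => (hB.pd μ).pd μ).neg

theorem SmoothMat.lap_iterate (hB : SmoothMat B) (k : ℕ) : SmoothMat (SpectralYM.lap^[k] B) := by
  induction k with
  | zero => exact hB
  | succ k ih => rw [Function.iterate_succ_apply']; exact ih.lap

theorem SmoothMat.divergence {A : Fin 4 → MatField N G} (hA : ∀ μ, SmoothMat (A μ)) :
    SmoothMat (divergence A) := SmoothMat.sum fun μ _ => (hA μ).pd μ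

theorem SmoothMat.trace (hB : SmoothMat B) : ContDiff ℝ ∞ fun x => (B x).trace :=
  ContDiff.sum fun a _ => hB a a

theorem fderiv_trace (hB : SmoothMat B) (μ : Fin 4) (x : E4) :
    fderiv ℝ (fun y => (B y).trace) x (frame μ) = (pd μ B x).trace := by
  have h : HasFDerivAt (fun y => (B y).trace) _ x :=
    HasFDerivAt.fun_sum fun a (_ : a ∈ Finset.univ) => hB.hasFDerivAt x a a
  rw [h.fderiv, _root_.sum_apply]
  rfl

theorem pd_const (μ : Fin 4) (M : Matrix (Fin N) (Fin N) G) (x : E4) :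
    pd μ (fun _ => M) x = 0 := by
  rw [pd_eq_of_hasFDerivAt fun a b => hasFDerivAt_const (M a b) x]; rfl

theorem pd_add (hB : SmoothMat B) (hC : SmoothMat C) (μ : Fin 4) (x : E4) :
    pd μ (fun y => B y + C y) x = pd μ B x + pd μ C x :=
  (pd_eq_of_hasFDerivAt (B := fun y => B y + C y) fun a b =>
    (hB.hasFDerivAt x a b).fun_add (hC.hasFDerivAt x a b)).trans rfl

theorem pd_neg (hB : SmoothMat B) (μ : Fin 4) (x : E4) :
    pd μ (fun y => -B y) x = -pd μ B x :=
  (pd_eq_of_hasFDerivAt (B := fun y => -B y) fun a b =>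
    (hB.hasFDerivAt x a b).fun_neg).trans rfl

theorem pd_real_smul (r : ℝ) (hB : SmoothMat B) (μ : Fin 4) (x : E4) :
    pd μ (fun y => r • B y) x = r • pd μ B x :=
  (pd_eq_of_hasFDerivAt (B := fun y => r • B y) fun a b =>
    (hB.hasFDerivAt x a b).fun_const_smul r).trans rfl

theorem pd_left_smul (g : G) (hB : SmoothMat B) (μ : Fin 4) (x : E4) :
    pd μ (fun y => g • B y) x = g • pd μ B x :=
  (pd_eq_of_hasFDerivAt (B := fun y => g • B y) fun a b =>
    (hB.hasFDerivAt x a b).const_mul g).trans rfl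

theorem pd_sum {ι : Type*} {s : Finset ι} {f : ι → MatField N G}
    (hf : ∀ i ∈ s, SmoothMat (f i)) (μ : Fin 4) (x : E4) :
    pd μ (fun y => ∑ i ∈ s, f i y) x = ∑ i ∈ s, pd μ (f i) x := by
  have h : ∀ a b, HasFDerivAt (fun y => (∑ i ∈ s, f i y) a b)
      (∑ i ∈ s, fderiv ℝ (fun y => f i y a b) x) x := fun a b => by
    simp only [Matrix.sum_apply]
    exact HasFDerivAt.fun_sum fun i hi => (hf i hi).hasFDerivAt x a b
  rw [pd_eq_of_hasFDerivAt h]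
  ext a b
  simp [pd, Matrix.sum_apply]

theorem pd_mul (hB : SmoothMat B) (hC : SmoothMat C) (μ : Fin 4) (x : E4) :
    pd μ (fun y => B y * C y) x = pd μ B x * C x + B x * pd μ C x := by
  have h : ∀ a b, HasFDerivAt (fun y => (B y * C y) a b) _ x := fun a b => by
    simp only [Matrix.mul_apply]
    exact HasFDerivAt.fun_sum fun c (_ : c ∈ Finset.univ) =>
      (hB.hasFDerivAt x a c).mul' (hC.hasFDerivAt x c b)
  rw [pd_eq_of_hasFDerivAt h]
  ext a b
  simp only [Matrix.of_apply, _root_.sum_apply, Matrix.add_apply, Matrix.mul_apply,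
    ← Finset.sum_add_distrib]
  refine Finset.sum_congr rfl fun c _ => ?_
  rw [add_comm]
  rfl

theorem pd_comm (hB : SmoothMat B) (μ ν : Fin 4) : pd μ (pd ν B) = pd ν (pd μ B) := by
  funext x
  ext a b
  have hs : IsSymmSndFDerivAt ℝ (fun y => B y a b) x :=
    (hB a b).contDiffAt.isSymmSndFDerivAt (by
      simpa using WithTop.coe_le_coe.2 (le_top (a := (2 : ℕ∞))))
  have hd : DifferentiableAt ℝ (fderiv ℝ fun y => B y a b) x :=
    ((hB a b).fderiv_right (m := ∞) (by simp)).differentiable (by simp) x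
  have h : ∀ v w : E4, fderiv ℝ (fun y => fderiv ℝ (fun z => B z a b) y v) x w =
      fderiv ℝ (fderiv ℝ fun y => B y a b) x w v := fun v w => by
    rw [fderiv_clm_apply hd (differentiableAt_const v)]
    simp
  change fderiv ℝ (fun y => fderiv ℝ (fun z => B z a b) y (frame ν)) x (frame μ) =
    fderiv ℝ (fun y => fderiv ℝ (fun z => B z a b) y (frame μ)) x (frame ν)
  rw [h, h]
  exact hs _ _

theorem lap_eq_neg_divergence (B : MatField N G) :
    lap B = fun x => -divergence (fun μ => pd μ B) x := rfl

theorem lap_sum {ι : Type*} {s : Finset ι} {f : ι → MatField N G}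
    (hf : ∀ i ∈ s, SmoothMat (f i)) (x : E4) :
    lap (fun y => ∑ i ∈ s, f i y) x = ∑ i ∈ s, lap (f i) x := by
  have h : ∀ μ, pd μ (fun y => ∑ i ∈ s, f i y) = fun x => ∑ i ∈ s, pd μ (f i) x := fun μ =>
    funext (pd_sum hf μ)
  simp only [lap, h, fun μ => pd_sum (fun i hi => (hf i hi).pd μ) μ x, Finset.sum_neg_distrib]
  rw [Finset.sum_comm]

theorem lap_real_smul (r : ℝ) (hB : SmoothMat B) (x : E4) :
    lap (fun y => r • B y) x = r • lap B x := by
  have h : ∀ μ, pd μ (fun y => r • B y) = fun x => r • pd μ B x := fun μ =>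
    funext (pd_real_smul r hB μ)
  simp only [lap, h, fun μ => pd_real_smul r (hB.pd μ) μ x, smul_neg, Finset.smul_sum]

theorem lap_left_smul (g : G) (hB : SmoothMat B) (x : E4) :
    lap (fun y => g • B y) x = g • lap B x := by
  have h : ∀ μ, pd μ (fun y => g • B y) = fun x => g • pd μ B x := fun μ =>
    funext (pd_left_smul g hB μ)
  simp only [lap, h, fun μ => pd_left_smul g (hB.pd μ) μ x, smul_neg, Finset.smul_sum]

theorem lap_add (hB : SmoothMat B) (hC : SmoothMat C) (x : E4) :
    lap (fun y => B y + C y) x = lap B x + lap C x := by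
  have h : ∀ μ, pd μ (fun y => B y + C y) = fun x => pd μ B x + pd μ C x := fun μ =>
    funext (pd_add hB hC μ)
  simp only [lap, h, fun μ => pd_add (hB.pd μ) (hC.pd μ) μ x, Finset.sum_add_distrib, neg_add]

theorem pd_lap (hB : SmoothMat B) (μ : Fin 4) : pd μ (lap B) = lap (pd μ B) := by
  funext x
  have h : pd μ (lap B) x = -∑ ν, pd μ (pd ν (pd ν B)) x := by
    rw [← pd_sum fun ν _ => (hB.pd ν).pd ν]
    exact pd_neg (SmoothMat.sum fun ν _ => (hB.pd ν).pd ν) μ x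
  rw [h, lap]
  congr 1
  refine Finset.sum_congr rfl fun ν _ => ?_
  rw [pd_comm (hB.pd ν) μ ν, pd_comm hB μ ν]

theorem divergence_lap {A : Fin 4 → MatField N G} (hA : ∀ μ, SmoothMat (A μ)) :
    divergence (fun μ => lap (A μ)) = lap (divergence A) := by
  funext x
  change ∑ μ, pd μ (lap (A μ)) x = lap (fun y => ∑ μ, pd μ (A μ) y) x
  rw [lap_sum fun μ _ => (hA μ).pd μ]
  exact Finset.sum_congr rfl fun μ _ => by rw [pd_lap (hA μ)]

theorem divergence_lap_iterate {A : Fin 4 → MatField N G} (hA : ∀ μ, SmoothMat (A μ)) (k : ℕ) :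
    divergence (fun μ => lap^[k] (A μ)) = lap^[k] (divergence A) := by
  induction k with
  | zero => rfl
  | succ k ih =>
    simp only [Function.iterate_succ_apply']
    rw [divergence_lap fun μ => (hA μ).lap_iterate k, ih]

end MatCalculus

/-! ### Equivariance of the differential operators and integration by parts on `E4 / Γ` -/

section Equivariance

variable {N : ℕ} {G : Type*} [NormedRing G] [NormedAlgebra ℂ G]
  {Γ : Type*} [Group Γ] {ρ : Γ →* Matrix.specialUnitaryGroup (Fin N) ℂ}

theorem conjBy_add (s : Γ) (X Y : Matrix (Fin N) (Fin N) G) :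
    conjBy ρ s (X + Y) = conjBy ρ s X + conjBy ρ s Y := by
  simp [conjBy, mul_add, add_mul]

theorem conjBy_sub (s : Γ) (X Y : Matrix (Fin N) (Fin N) G) :
    conjBy ρ s (X - Y) = conjBy ρ s X - conjBy ρ s Y := by
  simp [conjBy, mul_sub, sub_mul]

theorem conjBy_neg (s : Γ) (X : Matrix (Fin N) (Fin N) G) :
    conjBy ρ s (-X) = -conjBy ρ s X := by
  simp [conjBy]

theorem conjBy_sum {ι : Type*} (t : Finset ι) (s : Γ) (f : ι → Matrix (Fin N) (Fin N) G) :
    conjBy ρ s (∑ i ∈ t, f i) = ∑ i ∈ t, conjBy ρ s (f i) := by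
  simp [conjBy, Finset.mul_sum, Finset.sum_mul]

theorem map_algebraMap_mul (s t : Γ) :
    ((ρ s : Matrix (Fin N) (Fin N) ℂ).map (algebraMap ℂ G)) *
      ((ρ t : Matrix (Fin N) (Fin N) ℂ).map (algebraMap ℂ G)) =
      ((ρ (s * t) : Matrix (Fin N) (Fin N) ℂ).map (algebraMap ℂ G)) := by
  rw [← Matrix.map_mul, map_mul]; rfl

theorem map_algebraMap_one :
    ((ρ 1 : Matrix (Fin N) (Fin N) ℂ).map (algebraMap ℂ G)) = 1 := by
  simp

theorem conjBy_mul (s : Γ) (X Y : Matrix (Fin N) (Fin N) G) :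
    conjBy ρ s (X * Y) = conjBy ρ s X * conjBy ρ s Y := by
  have h := map_algebraMap_mul (ρ := ρ) (G := G) s⁻¹ s
  rw [inv_mul_cancel, map_algebraMap_one] at h
  simp only [conjBy]
  generalize ((ρ s : Matrix (Fin N) (Fin N) ℂ).map (algebraMap ℂ G)) = P at h ⊢
  generalize ((ρ s⁻¹ : Matrix (Fin N) (Fin N) ℂ).map (algebraMap ℂ G)) = Q at h ⊢
  calc P * (X * Y) * Q = P * X * 1 * Y * Q := by simp only [mul_one, mul_assoc]
    _ = P * X * Q * (P * Y * Q) := by rw [← h]; simp only [mul_assoc]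

/-- Cyclicity fails for general matrices over `G`, but the holonomy matrices have complex, hence
central, entries. -/
theorem trace_conjBy (s : Γ) (X : Matrix (Fin N) (Fin N) G) :
    (conjBy ρ s X).trace = X.trace := by
  have h := map_algebraMap_mul (ρ := ρ) (G := G) s⁻¹ s
  rw [inv_mul_cancel, map_algebraMap_one] at h
  have hc : ∀ (M : Matrix (Fin N) (Fin N) ℂ) (Y : Matrix (Fin N) (Fin N) G),
      (Y * M.map (algebraMap ℂ G)).trace = (M.map (algebraMap ℂ G) * Y).trace := by
    intro M Y
    simp only [Matrix.trace, Matrix.diag, Matrix.mul_apply, Matrix.map_apply]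
    rw [Finset.sum_comm]
    exact Finset.sum_congr rfl fun i _ => Finset.sum_congr rfl fun j _ =>
      (Algebra.commutes _ _).symm
  rw [conjBy, hc, ← mul_assoc, h, one_mul]

theorem SmoothMat.conjBy {B : MatField N G} (hB : SmoothMat B) (s : Γ) :
    SmoothMat fun x => conjBy ρ s (B x) :=
  ((SmoothMat.const _).mul hB).mul (SmoothMat.const _)

theorem pd_conjBy {B : MatField N G} (hB : SmoothMat B) (s : Γ) (μ : Fin 4) (x : E4) :
    pd μ (fun y => conjBy ρ s (B y)) x = conjBy ρ s (pd μ B x) := by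
  simp only [conjBy]
  rw [pd_mul ((SmoothMat.const _).mul hB) (SmoothMat.const _), pd_mul (SmoothMat.const _) hB,
    pd_const, pd_const]
  simp

theorem lap_conjBy {B : MatField N G} (hB : SmoothMat B) (s : Γ) (x : E4) :
    lap (fun y => conjBy ρ s (B y)) x = conjBy ρ s (lap B x) := by
  have h : ∀ μ, pd μ (fun y => conjBy ρ s (B y)) = fun x => conjBy ρ s (pd μ B x) := fun μ =>
    funext (pd_conjBy hB s μ)
  simp only [lap, h, fun μ => pd_conjBy (ρ := ρ) (hB.pd μ) s μ x, conjBy_neg, conjBy_sum]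

variable [MulAction Γ E4] [IsIsometricSMul Γ E4]

theorem SmoothMat.comp_deck {B : MatField N G} (hB : SmoothMat B) (s : Γ) :
    SmoothMat fun x => B (s • x) := fun a b => (hB a b).comp (contDiff_deck s)

theorem pd_comp_deck {B : MatField N G} (hB : SmoothMat B) (s : Γ) (μ : Fin 4) (x : E4) :
    pd μ (fun y => B (s • y)) x = ∑ ν, deckMat s μ ν • pd ν B (s • x) := by
  ext a b
  simp only [Matrix.sum_apply, Matrix.smul_apply]
  exact fderiv_comp_deck (hB a b) s x μ

theorem lap_comp_deck {B : MatField N G} (hB : SmoothMat B) (s : Γ) (x : E4) :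
    lap (fun y => B (s • y)) x = lap B (s • x) := by
  have h : ∀ μ, pd μ (fun y => B (s • y)) = fun x => ∑ ν, deckMat s μ ν • pd ν B (s • x) :=
    fun μ => funext (pd_comp_deck hB s μ)
  have h2 : ∀ μ, pd μ (fun x => ∑ ν, deckMat s μ ν • pd ν B (s • x)) x =
      ∑ ν, deckMat s μ ν • ∑ κ, deckMat s μ κ • pd κ (pd ν B) (s • x) := fun μ => by
    rw [pd_sum fun ν _ => ((hB.pd ν).comp_deck s).real_smul _]
    refine Finset.sum_congr rfl fun ν _ => ?_
    rw [pd_real_smul _ ((hB.pd ν).comp_deck s), pd_comp_deck (hB.pd ν)]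
  simp only [lap, h, h2]
  rw [Finset.sum_comm]
  simp only [sum_deckMat_smul_sum]

theorem isAdjOneForm_iff {A : Fin 4 → MatField N G} : IsAdjOneForm ρ A ↔
    ∀ (s : Γ) (x : E4) (ν : Fin 4), A ν (s • x) = ∑ μ, deckMat s μ ν • conjBy ρ s (A μ x) := by
  unfold IsAdjOneForm
  simp only [fderiv_deck_apply]
  refine forall_congr' fun s => forall_congr' fun x => ⟨fun h ν => ?_, fun h μ => ?_⟩
  · simp only [← h, sum_deckMat_smul_sum]
  · simp only [h, Finset.smul_sum, smul_smul]
    rw [Finset.sum_comm]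
    simp only [← Finset.sum_smul, deckMat_sum_right, ite_smul, one_smul, zero_smul]
    simp

theorem IsAdjOneForm.sum_deckMat {A : Fin 4 → MatField N G} (hA : IsAdjOneForm ρ A) (s : Γ)
    (x : E4) (μ : Fin 4) : ∑ ν, deckMat s μ ν • A ν (s • x) = conjBy ρ s (A μ x) := by
  have := hA s x μ
  simpa only [fderiv_deck_apply] using this

theorem IsAdjSection.pd {B : MatField N G} (hB : SmoothMat B) (h : IsAdjSection ρ B) :
    IsAdjOneForm ρ fun μ => pd μ B := by
  intro s x μ
  simp only [fderiv_deck_apply]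
  rw [← pd_comp_deck hB, ← pd_conjBy hB]
  congr 1
  funext y
  exact h s y

theorem IsAdjOneForm.divergence {A : Fin 4 → MatField N G} (hA : ∀ μ, SmoothMat (A μ))
    (h : IsAdjOneForm ρ A) : IsAdjSection ρ (divergence A) := by
  intro s x
  -- The derivative of `x ↦ A κ (s • x)` is computed twice, by the chain rule and by equivariance.
  -- Orthogonality of `deckMat` then solves for the derivatives at `s • x`.
  have h1 : ∀ ν κ, ∑ μ, deckMat s ν μ • SpectralYM.pd μ (A κ) (s • x) =
      ∑ μ, deckMat s μ κ • conjBy ρ s (SpectralYM.pd ν (A μ) x) := fun ν κ => by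
    rw [← pd_comp_deck (hA κ)]
    have e : (fun y => A κ (s • y)) = fun y => ∑ μ, deckMat s μ κ • conjBy ρ s (A μ y) :=
      funext fun y => isAdjOneForm_iff.1 h s y κ
    rw [e, pd_sum fun μ _ => ((hA μ).conjBy s).real_smul _]
    refine Finset.sum_congr rfl fun μ _ => ?_
    rw [pd_real_smul _ ((hA μ).conjBy s), pd_conjBy (hA μ)]
  have h2 : ∀ κ, SpectralYM.pd κ (A κ) (s • x) =
      ∑ ν, deckMat s ν κ • ∑ μ, deckMat s μ κ • conjBy ρ s (SpectralYM.pd ν (A μ) x) := fun κ => by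
    simp only [← h1]
    rw [sum_deckMat_smul_sum]
  simp only [SpectralYM.divergence, h2, Finset.smul_sum, smul_smul, conjBy_sum]
  rw [Finset.sum_comm]
  refine Finset.sum_congr rfl fun ν _ => ?_
  rw [Finset.sum_comm]
  simp only [← Finset.sum_smul, deckMat_sum_right, ite_smul, one_smul, zero_smul]
  simp

theorem IsAdjSection.lap {B : MatField N G} (hB : SmoothMat B) (h : IsAdjSection ρ B) :
    IsAdjSection ρ (lap B) := by
  intro s x
  rw [← lap_comp_deck hB, ← lap_conjBy hB]
  congr 1
  funext y
  exact h s y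

theorem IsAdjOneForm.lap {A : Fin 4 → MatField N G} (hA : ∀ μ, SmoothMat (A μ))
    (h : IsAdjOneForm ρ A) : IsAdjOneForm ρ fun μ => lap (A μ) := by
  rw [isAdjOneForm_iff]
  intro s x ν
  rw [← lap_comp_deck (hA ν)]
  have e : (fun y => A ν (s • y)) = fun y => ∑ μ, deckMat s μ ν • conjBy ρ s (A μ y) :=
    funext fun y => isAdjOneForm_iff.1 h s y ν
  rw [e, lap_sum fun μ _ => ((hA μ).conjBy s).real_smul _]
  refine Finset.sum_congr rfl fun μ _ => ?_
  rw [lap_real_smul _ ((hA μ).conjBy s), lap_conjBy (hA μ)]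

theorem IsAdjSection.lap_iterate {B : MatField N G} (hB : SmoothMat B) (h : IsAdjSection ρ B)
    (k : ℕ) : IsAdjSection ρ (SpectralYM.lap^[k] B) := by
  induction k with
  | zero => exact h
  | succ k ih => rw [Function.iterate_succ_apply']; exact ih.lap (hB.lap_iterate k)

theorem IsAdjOneForm.lap_iterate {A : Fin 4 → MatField N G} (hA : ∀ μ, SmoothMat (A μ))
    (h : IsAdjOneForm ρ A) (k : ℕ) : IsAdjOneForm ρ fun μ => SpectralYM.lap^[k] (A μ) := by
  induction k with
  | zero => exact h
  | succ k ih =>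
    simp only [Function.iterate_succ_apply']
    exact ih.lap fun μ => (hA μ).lap_iterate k

theorem IsAdjOneForm.covD {A : Fin 4 → MatField N G} {C : MatField N G}
    (hA : IsAdjOneForm ρ A) (hCs : SmoothMat C) (hC : IsAdjSection ρ C) :
    IsAdjOneForm ρ (covD A C) := by
  intro s x μ
  have h1 := hA.sum_deckMat s x μ
  have h2 := (hC.pd hCs).sum_deckMat s x μ
  simp only [fderiv_deck_apply, SpectralYM.covD, smul_add, smul_sub, Finset.sum_add_distrib,
    Finset.sum_sub_distrib, conjBy_add, conjBy_sub, conjBy_mul, h2, ← h1, hC s x,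
    Finset.sum_mul, Finset.mul_sum, smul_mul_assoc, mul_smul_comm]

variable [ProperlyDiscontinuousSMul Γ E4] [CompactSpace (MulAction.orbitRel.Quotient Γ E4)]
  {F : Set E4}

theorem integrableOn_trace_mul (hF : IsFundamentalDomain Γ F volume) {u v : MatField N G}
    (hu : SmoothMat u) (hv : SmoothMat v) (hu' : IsAdjSection ρ u) (hv' : IsAdjSection ρ v) :
    IntegrableOn (fun x => (u x * v x).trace) F :=
  integrableOn_of_invariant hF (hu.mul hv).trace.continuous fun s x => by
    rw [hu' s x, hv' s x, ← conjBy_mul, trace_conjBy]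

theorem sum_trace_mul_invariant {A B : Fin 4 → MatField N G} (hA : IsAdjOneForm ρ A)
    (hB : IsAdjOneForm ρ B) (s : Γ) (x : E4) :
    ∑ μ, (A μ (s • x) * B μ (s • x)).trace = ∑ μ, (A μ x * B μ x).trace := by
  simp only [isAdjOneForm_iff.1 hA s x, isAdjOneForm_iff.1 hB s x, Finset.sum_mul,
    Finset.mul_sum, Matrix.trace_sum, smul_mul_assoc, mul_smul_comm, Matrix.trace_smul,
    ← conjBy_mul, trace_conjBy]
  rw [Finset.sum_comm]
  refine Finset.sum_congr rfl fun μ _ => ?_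
  simp only [Finset.smul_sum]
  rw [Finset.sum_comm]
  simp only [smul_smul, ← Finset.sum_smul, deckMat_sum_right, ite_smul, one_smul, zero_smul]
  simp

theorem integrableOn_sum_trace_mul (hF : IsFundamentalDomain Γ F volume)
    {A B : Fin 4 → MatField N G} (hA : ∀ μ, SmoothMat (A μ)) (hB : ∀ μ, SmoothMat (B μ))
    (hA' : IsAdjOneForm ρ A) (hB' : IsAdjOneForm ρ B) :
    IntegrableOn (fun x => ∑ μ, (A μ x * B μ x).trace) F :=
  integrableOn_of_invariant hF
    (continuous_finsetSum _ fun μ _ => ((hA μ).mul (hB μ)).trace.continuous)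
    (sum_trace_mul_invariant hA' hB')

variable [CompleteSpace G]

theorem setIntegral_trace_pd_mul (hF : IsFundamentalDomain Γ F volume) {u : MatField N G}
    {B : Fin 4 → MatField N G} (hu : SmoothMat u) (hB : ∀ μ, SmoothMat (B μ))
    (hu' : IsAdjSection ρ u) (hB' : IsAdjOneForm ρ B) :
    ∫ x in F, ∑ μ, (pd μ u x * B μ x).trace = -∫ x in F, (u x * divergence B x).trace := by
  have h0 : ∀ x, ∑ μ, fderiv ℝ (fun y => (u y * B μ y).trace) x (frame μ) =
      ∑ μ, (pd μ u x * B μ x).trace + (u x * divergence B x).trace := fun x => by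
    simp only [fun μ => fderiv_trace (hu.mul (hB μ)) μ x, fun μ => pd_mul hu (hB μ) μ x,
      Matrix.trace_add, Finset.sum_add_distrib, divergence, Finset.mul_sum, Matrix.trace_sum]
  have h := setIntegral_divergence_eq_zero hF (V := fun μ x => (u x * B μ x).trace)
    (fun μ => (hu.mul (hB μ)).trace) (fun s x μ => by
      have := hB'.sum_deckMat s x μ
      simp only [← Matrix.trace_smul, ← Matrix.trace_sum, ← mul_smul_comm, ← Finset.mul_sum, this]
      rw [hu' s x, ← conjBy_mul, trace_conjBy])
    (fun s x => by
      rw [h0, h0, sum_trace_mul_invariant (hu'.pd hu) hB', hu' s x, hB'.divergence hB s x,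
        ← conjBy_mul, trace_conjBy])
  simp only [h0] at h
  rw [integral_add (integrableOn_sum_trace_mul hF (fun μ => hu.pd μ) hB (hu'.pd hu) hB')
    (integrableOn_trace_mul hF hu (SmoothMat.divergence hB) hu' (hB'.divergence hB))] at h
  exact eq_neg_of_add_eq_zero_left h

/-- The mirror image of `setIntegral_trace_pd_mul`. It is proved separately since the factors under
the trace cannot be exchanged without information on parity. -/
theorem setIntegral_trace_mul_pd (hF : IsFundamentalDomain Γ F volume) {u : MatField N G}
    {B : Fin 4 → MatField N G} (hu : SmoothMat u) (hB : ∀ μ, SmoothMat (B μ))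
    (hu' : IsAdjSection ρ u) (hB' : IsAdjOneForm ρ B) :
    ∫ x in F, ∑ μ, (B μ x * pd μ u x).trace = -∫ x in F, (divergence B x * u x).trace := by
  have h0 : ∀ x, ∑ μ, fderiv ℝ (fun y => (B μ y * u y).trace) x (frame μ) =
      ∑ μ, (B μ x * pd μ u x).trace + (divergence B x * u x).trace := fun x => by
    simp only [fun μ => fderiv_trace ((hB μ).mul hu) μ x, fun μ => pd_mul (hB μ) hu μ x,
      Matrix.trace_add, Finset.sum_add_distrib, divergence, Finset.sum_mul, Matrix.trace_sum]
    rw [add_comm]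
  have h := setIntegral_divergence_eq_zero hF (V := fun μ x => (B μ x * u x).trace)
    (fun μ => ((hB μ).mul hu).trace) (fun s x μ => by
      have := hB'.sum_deckMat s x μ
      simp only [← Matrix.trace_smul, ← Matrix.trace_sum, ← smul_mul_assoc, ← Finset.sum_mul, this]
      rw [hu' s x, ← conjBy_mul, trace_conjBy])
    (fun s x => by
      rw [h0, h0, sum_trace_mul_invariant hB' (hu'.pd hu), hu' s x, hB'.divergence hB s x,
        ← conjBy_mul, trace_conjBy])
  simp only [h0] at h
  rw [integral_add (integrableOn_sum_trace_mul hF hB (fun μ => hu.pd μ) hB' (hu'.pd hu))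
    (integrableOn_trace_mul hF (SmoothMat.divergence hB) hu (hB'.divergence hB) hu')] at h
  exact eq_neg_of_add_eq_zero_left h

/-- Both sides equal the Dirichlet form `∫ ∑ tr ∂_μ u ∂_μ v`. The order of the factors is preserved
throughout, so no signs appear for odd fields. -/
theorem setIntegral_trace_mul_lap (hF : IsFundamentalDomain Γ F volume) {u v : MatField N G}
    (hu : SmoothMat u) (hv : SmoothMat v) (hu' : IsAdjSection ρ u) (hv' : IsAdjSection ρ v) :
    ∫ x in F, (u x * lap v x).trace = ∫ x in F, (lap u x * v x).trace := by
  simp only [lap_eq_neg_divergence, mul_neg, neg_mul, Matrix.trace_neg, integral_neg]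
  rw [← setIntegral_trace_pd_mul hF hu (fun μ => hv.pd μ) hu' (hv'.pd hv),
    ← setIntegral_trace_mul_pd hF hv (fun μ => hu.pd μ) hv' (hu'.pd hu)]

theorem setIntegral_trace_mul_lap_iterate (hF : IsFundamentalDomain Γ F volume)
    {u v : MatField N G} (hu : SmoothMat u) (hv : SmoothMat v) (hu' : IsAdjSection ρ u)
    (hv' : IsAdjSection ρ v) (k : ℕ) :
    ∫ x in F, (u x * (lap^[k] v) x).trace = ∫ x in F, ((lap^[k] u) x * v x).trace := by
  induction k generalizing u with
  | zero => rfl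
  | succ k ih =>
    rw [Function.iterate_succ_apply', setIntegral_trace_mul_lap hF hu (hv.lap_iterate k) hu'
      (hv'.lap_iterate hv k), ih hu.lap (hu'.lap hu), Function.iterate_succ_apply]

end Equivariance

/-! ### Sign rules for even and odd matrices -/

section Parity

variable {N : ℕ} {G : Type*} [NormedRing G] [NormedAlgebra ℂ G]
  {𝒢 : ZMod 2 → Submodule ℂ G}

/-- Matrices with entries of parity `i`. -/
def HasParity (𝒢 : ZMod 2 → Submodule ℂ G) (i : ZMod 2) (X : Matrix (Fin N) (Fin N) G) : Prop :=
  ∀ a b, X a b ∈ 𝒢 i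

theorem HasParity.add {i : ZMod 2} {X Y : Matrix (Fin N) (Fin N) G} (hX : HasParity 𝒢 i X)
    (hY : HasParity 𝒢 i Y) : HasParity 𝒢 i (X + Y) := fun a b => (𝒢 i).add_mem (hX a b) (hY a b)

theorem HasParity.sub {i : ZMod 2} {X Y : Matrix (Fin N) (Fin N) G} (hX : HasParity 𝒢 i X)
    (hY : HasParity 𝒢 i Y) : HasParity 𝒢 i (X - Y) := fun a b => (𝒢 i).sub_mem (hX a b) (hY a b)

theorem HasParity.sum {ι : Type*} {t : Finset ι} {i : ZMod 2}
    {f : ι → Matrix (Fin N) (Fin N) G} (hf : ∀ k ∈ t, HasParity 𝒢 i (f k)) :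
    HasParity 𝒢 i (∑ k ∈ t, f k) := fun a b => by
  rw [Matrix.sum_apply]
  exact Submodule.sum_mem _ fun k hk => hf k hk a b

theorem HasParity.mul [GradedAlgebra 𝒢] {i j : ZMod 2} {X Y : Matrix (Fin N) (Fin N) G}
    (hX : HasParity 𝒢 i X) (hY : HasParity 𝒢 j Y) : HasParity 𝒢 (i + j) (X * Y) := fun a b => by
  rw [Matrix.mul_apply]
  exact Submodule.sum_mem _ fun c _ => SetLike.mul_mem_graded (hX a c) (hY c b)

theorem HasParity.left_smul [GradedAlgebra 𝒢] {i j : ZMod 2} {g : G} (hg : g ∈ 𝒢 i)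
    {X : Matrix (Fin N) (Fin N) G} (hX : HasParity 𝒢 j X) : HasParity 𝒢 (i + j) (g • X) :=
  fun a b => SetLike.mul_mem_graded hg (hX a b)

theorem HasParity.pd [GradedAlgebra 𝒢] (h𝒢 : IsSupercommutative 𝒢) {i : ZMod 2} {B : MatField N G}
    (hB : SmoothMat B) (h : ∀ x, HasParity 𝒢 i (B x)) (μ : Fin 4) (x : E4) :
    HasParity 𝒢 i (pd μ B x) :=
  fun a b => fderiv_mem_graded h𝒢 (hB a b) (fun y => h y a b) _ _

theorem HasParity.divergence [GradedAlgebra 𝒢] (h𝒢 : IsSupercommutative 𝒢) {i : ZMod 2} {A : Fin 4 → MatField N G}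
    (hA : ∀ μ, SmoothMat (A μ)) (h : ∀ μ x, HasParity 𝒢 i (A μ x)) (x : E4) :
    HasParity 𝒢 i (divergence A x) := HasParity.sum fun μ _ => HasParity.pd h𝒢 (hA μ) (h μ) μ x

variable {X Y : Matrix (Fin N) (Fin N) G} {ε : G}

theorem mul_smul_of_even (h𝒢 : IsSupercommutative 𝒢) (hX : HasParity 𝒢 0 X) (ε : G)
    (Y : Matrix (Fin N) (Fin N) G) : X * (ε • Y) = ε • (X * Y) := by
  ext a b
  simp only [Matrix.mul_apply, Matrix.smul_apply, smul_eq_mul, Finset.mul_sum, ← mul_assoc]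
  exact Finset.sum_congr rfl fun c _ => by rw [h𝒢.even_comm _ (hX a c) ε]

theorem mul_smul_of_odd (h𝒢 : IsSupercommutative 𝒢) (hX : HasParity 𝒢 1 X) (hε : ε ∈ 𝒢 1)
    (Y : Matrix (Fin N) (Fin N) G) : X * (ε • Y) = -(ε • (X * Y)) := by
  ext a b
  simp only [Matrix.mul_apply, Matrix.smul_apply, smul_eq_mul, Finset.mul_sum, ← mul_assoc,
    Matrix.neg_apply, ← Finset.sum_neg_distrib]
  exact Finset.sum_congr rfl fun c _ => by rw [h𝒢.odd_anticomm _ (hX a c) ε hε, neg_mul]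

theorem odd_mul_self (h𝒢 : IsSupercommutative 𝒢) (hε : ε ∈ 𝒢 1) : ε * ε = 0 := by
  have h := h𝒢.odd_anticomm ε hε ε hε
  have h2 : (2 : ℂ) • (ε * ε) = 0 := by rw [two_smul]; nth_rewrite 1 [h]; abel
  exact (smul_eq_zero.1 h2).resolve_left two_ne_zero

theorem odd_smul_odd_smul (h𝒢 : IsSupercommutative 𝒢) (hε : ε ∈ 𝒢 1)
    (X : Matrix (Fin N) (Fin N) G) : ε • ε • X = 0 := by
  rw [smul_smul, odd_mul_self h𝒢 hε, zero_smul]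

/-- Moving the second `ε` past `X` costs only a sign and leaves `ε² = 0`. Thus all BRST variations
are exact to first order. -/
theorem smul_mul_smul_of_odd (h𝒢 : IsSupercommutative 𝒢) (hX : HasParity 𝒢 1 X) (hε : ε ∈ 𝒢 1)
    (Y : Matrix (Fin N) (Fin N) G) : (ε • X) * (ε • Y) = 0 := by
  rw [smul_mul_assoc, mul_smul_of_odd h𝒢 hX hε, smul_neg, odd_smul_odd_smul h𝒢 hε, neg_zero]

theorem smul_mul_smul_of_even (h𝒢 : IsSupercommutative 𝒢) (hX : HasParity 𝒢 0 X) (hε : ε ∈ 𝒢 1)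
    (Y : Matrix (Fin N) (Fin N) G) : (ε • X) * (ε • Y) = 0 := by
  rw [smul_mul_assoc, mul_smul_of_even h𝒢 hX, odd_smul_odd_smul h𝒢 hε]

theorem trace_mul_comm_of_even (h𝒢 : IsSupercommutative 𝒢) (hX : HasParity 𝒢 0 X)
    (Y : Matrix (Fin N) (Fin N) G) : (X * Y).trace = (Y * X).trace := by
  simp only [Matrix.trace, Matrix.diag, Matrix.mul_apply]
  rw [Finset.sum_comm]
  exact Finset.sum_congr rfl fun a _ => Finset.sum_congr rfl fun b _ => h𝒢.even_comm _ (hX b a) _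

theorem covD_parity [GradedAlgebra 𝒢] (h𝒢 : IsSupercommutative 𝒢) {A : Fin 4 → MatField N G}
    {C : MatField N G} (hA : ∀ μ x, HasParity 𝒢 0 (A μ x)) (hCs : SmoothMat C)
    (hC : ∀ x, HasParity 𝒢 1 (C x)) (μ : Fin 4) (x : E4) : HasParity 𝒢 1 (covD A C μ x) := by
  have h1 : HasParity 𝒢 1 (A μ x * C x) := by simpa using (hA μ x).mul (hC x)
  have h2 : HasParity 𝒢 1 (C x * A μ x) := by simpa using (hC x).mul (hA μ x)
  exact (HasParity.pd h𝒢 hCs hC μ x).add (h1.sub h2)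

theorem SmoothMat.covD {A : Fin 4 → MatField N G} {C : MatField N G}
    (hA : ∀ μ, SmoothMat (A μ)) (hC : SmoothMat C) (μ : Fin 4) : SmoothMat (covD A C μ) :=
  (hC.pd μ).add (((hA μ).mul hC).sub (hC.mul (hA μ)))

end Parity

/-! ### BRST invariance of the three actions -/

section BRST

variable {N : ℕ} {G : Type*} [NormedRing G] [NormedAlgebra ℂ G]
  {𝒢 : ZMod 2 → Submodule ℂ G} [GradedAlgebra 𝒢] {A : Fin 4 → MatField N G} {C : MatField N G}
  {ε : G}

theorem brstC_eq (C : MatField N G) : brstC C = fun x => -(C x * C x) := by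
  funext x
  rw [brstC, ← two_smul ℝ (C x * C x), smul_smul]
  norm_num

/-- Nilpotency of the BRST transformation on the gauge field. -/
theorem covD_brst (h𝒢 : IsSupercommutative 𝒢) (hA : ∀ μ x, HasParity 𝒢 0 (A μ x))
    (hCs : SmoothMat C) (hC : ∀ x, HasParity 𝒢 1 (C x)) (hε : ε ∈ 𝒢 1) :
    covD (fun μ x => A μ x + ε • brstA A C μ x) (fun x => C x + ε • brstC C x) = covD A C := by
  funext μ x
  have hCC : HasParity 𝒢 0 (C x * C x) := (hC x).mul (hC x)
  have hB := covD_parity h𝒢 hA hCs hC μ x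
  have hsm : SmoothMat fun y => -(C y * C y) := (hCs.mul hCs).neg
  have h1 : pd μ (fun y => C y + ε • brstC C y) x =
      pd μ C x - ε • (pd μ C x * C x + C x * pd μ C x) := by
    rw [brstC_eq, pd_add hCs (hsm.left_smul ε), pd_left_smul ε hsm, pd_neg (hCs.mul hCs),
      pd_mul hCs hCs, smul_neg, sub_eq_add_neg]
  -- The heart of `s² A = 0`: the anticommutator of `D_μ C` with `C` is `D_μ (C²)`. The plus sign
  -- arises from moving `ε` past the odd `C`, and the right-hand side is what the variation of `C`
  -- subtracts.
  have h2 : covD A C μ x * C x + C x * covD A C μ x =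
      pd μ C x * C x + C x * pd μ C x + A μ x * (C x * C x) - C x * C x * A μ x := by
    simp only [covD]; noncomm_ring
  have h3 : (A μ x + ε • covD A C μ x) * (C x + ε • -(C x * C x)) =
      A μ x * C x - ε • (A μ x * (C x * C x)) + ε • (covD A C μ x * C x) := by
    rw [smul_neg, add_mul, mul_add, mul_add, mul_neg, mul_neg, mul_smul_of_even h𝒢 (hA μ x),
      smul_mul_smul_of_odd h𝒢 hB hε, smul_mul_assoc, neg_zero, add_zero, ← sub_eq_add_neg]
  have h4 : (C x + ε • -(C x * C x)) * (A μ x + ε • covD A C μ x) =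
      C x * A μ x - ε • (C x * covD A C μ x) - ε • (C x * C x * A μ x) := by
    rw [smul_neg, add_mul, mul_add, mul_add, neg_mul, neg_mul, mul_smul_of_odd h𝒢 (hC x) hε,
      smul_mul_smul_of_even h𝒢 hCC hε, smul_mul_assoc, neg_zero, add_zero]
    abel
  have h5 : covD (fun μ x => A μ x + ε • brstA A C μ x) (fun x => C x + ε • brstC C x) μ x =
      pd μ (fun y => C y + ε • brstC C y) x + ((A μ x + ε • covD A C μ x) * (C x + ε • -(C x * C x))
        - (C x + ε • -(C x * C x)) * (A μ x + ε • covD A C μ x)) := by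
    rw [brstC_eq]; rfl
  have h6 : ε • (covD A C μ x * C x) + ε • (C x * covD A C μ x) =
      ε • (pd μ C x * C x + C x * pd μ C x) + ε • (A μ x * (C x * C x)) -
        ε • (C x * C x * A μ x) := by
    rw [← smul_add, h2, smul_sub, smul_add]
  rw [h5, h1, h3, h4]
  have h7 : covD A C μ x = pd μ C x + (A μ x * C x - C x * A μ x) := rfl
  rw [h7, ← sub_eq_zero]
  rw [← sub_eq_zero] at h6
  rw [h7] at h6
  rw [← h6]
  abel

theorem IsEvenField.mul {B C : MatField N G} (hB : IsEvenField 𝒢 B) (hC : IsEvenField 𝒢 C) :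
    IsEvenField 𝒢 fun x => B x * C x where
  smooth := SmoothMat.mul hB.smooth hC.smooth
  mem x a b := by
    have := HasParity.mul (hB.mem x) (hC.mem x) a b
    simpa using this

theorem matOp_mul_eq_zero {B C : MatField N G} (hB : IsEvenField 𝒢 B) (hC : IsEvenField 𝒢 C)
    (h : ∀ x, B x * C x = 0) : matOp hB * matOp hC = 0 := by
  rw [matOp_mul hB hC (hB.mul hC)]
  ext ψ x i
  change ∑ b, (B x * C x) i.2 b * ψ.1 x (i.1, b) = 0
  simp [h]

/-- With `p` the derivative, `a` the gauge field and `w'` the derivative of `w`, the terms linear in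
`w` give `w' + [a, w]`. The quadratic terms `w p w` and `w a w` vanish, as each contains `ε` twice.
-/
theorem conj_connection {R : Type*} [Ring R] {p a w w' : R} (hp : p * w = w * p + w')
    (hww : w * w = 0) (hww' : w * w' = 0) (hwaw : w * (a * w) = 0) :
    p + (a + w' + a * w - w * a) = (1 - w) * ((p + a) * (1 + w)) := by
  have h1 : w * (p * w) = 0 := by rw [hp, mul_add, hww', ← mul_assoc, hww, zero_mul, add_zero]
  have e : (1 - w) * ((p + a) * (1 + w)) =
      p + a + p * w + a * w - w * p - w * a - w * (p * w) - w * (a * w) := by noncomm_ring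
  rw [e, h1, hwaw, hp]
  abel

/-- BRST invariance of the Seeley–De Witt invariants. -/
theorem seeleyDeWitt_brst [CompleteSpace G] (h𝒢 : IsSupercommutative 𝒢)
    {γ : Fin 4 → Matrix (Fin 4) (Fin 4) ℂ} (hγ : IsGamma γ)
    (hAs : ∀ μ, SmoothMat (A μ)) (hA : ∀ μ x, HasParity 𝒢 0 (A μ x))
    (hCs : SmoothMat C) (hC : ∀ x, HasParity 𝒢 1 (C x)) (hε : ε ∈ 𝒢 1) (m : ℕ) (x : E4) :
    seeleyDeWitt γ (fun μ x => A μ x + ε • brstA A C μ x) m x = seeleyDeWitt γ A m x := by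
  have hεX : ∀ {X : Matrix (Fin N) (Fin N) G}, HasParity 𝒢 1 X → HasParity 𝒢 0 (ε • X) :=
    fun hX => HasParity.left_smul hε hX
  have hAe : ∀ μ, IsEvenField 𝒢 (A μ) := fun μ => ⟨hAs μ, hA μ⟩
  have hA' : ∀ μ, IsEvenField 𝒢 (fun x => A μ x + ε • brstA A C μ x) := fun μ =>
    ⟨(hAs μ).add ((SmoothMat.covD hAs hCs μ).left_smul ε),
      fun x => (hA μ x).add (hεX (covD_parity h𝒢 hA hCs hC μ x))⟩
  have hw : IsEvenField 𝒢 (fun x => ε • C x) := ⟨hCs.left_smul ε, fun x => hεX (hC x)⟩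
  have hpd : ∀ μ x, pd μ (fun x => ε • C x) x = ε • pd μ C x := fun μ x =>
    pd_left_smul ε hCs μ x
  have hw' : ∀ μ, IsEvenField 𝒢 (pd μ fun x => ε • C x) := fun μ =>
    ⟨SmoothMat.pd μ (hCs.left_smul ε), fun x => by
      rw [hpd]; exact hεX (HasParity.pd h𝒢 hCs hC μ x)⟩
  refine seeleyDeWitt_congr_of_conj h𝒢 hγ hAe hA' hw
    (matOp_mul_eq_zero hw hw fun x => smul_mul_smul_of_odd h𝒢 (hC x) hε _) (fun μ => ?_) m x
  have hwaw : matOp hw * (matOp (hAe μ) * matOp hw) = 0 := by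
    rw [matOp_mul _ _ ((hAe μ).mul hw)]
    refine matOp_mul_eq_zero _ _ fun x => ?_
    rw [mul_smul_of_even h𝒢 (hA μ x), smul_mul_smul_of_odd h𝒢 (hC x) hε]
  have hww' : matOp hw * matOp (hw' μ) = 0 := matOp_mul_eq_zero _ _ fun x => by
    rw [hpd, smul_mul_smul_of_odd h𝒢 (hC x) hε]
  refine Eq.trans ?_ (conj_connection (R := Module.End ℂ (evenSpinor N 𝒢))
    (pdOp_comm_matOp h𝒢 hw μ (hw' μ))
    (matOp_mul_eq_zero hw hw fun x => smul_mul_smul_of_odd h𝒢 (hC x) hε _) hww' hwaw)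
  rw [nablaOp, matOp_mul _ _ ((hAe μ).mul hw), matOp_mul _ _ (hw.mul (hAe μ))]
  congr 1
  ext ψ x i
  change ∑ b, (A μ x + ε • brstA A C μ x) i.2 b * ψ.1 x (i.1, b) =
    ∑ b, A μ x i.2 b * ψ.1 x (i.1, b) + ∑ b, pd μ (fun x => ε • C x) x i.2 b * ψ.1 x (i.1, b) +
      ∑ b, (A μ x * (ε • C x)) i.2 b * ψ.1 x (i.1, b) -
      ∑ b, ((ε • C x) * A μ x) i.2 b * ψ.1 x (i.1, b)
  rw [← Finset.sum_add_distrib, ← Finset.sum_add_distrib, ← Finset.sum_sub_distrib]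
  refine Finset.sum_congr rfl fun b _ => ?_
  -- Since `A` is even, `ε` passes through it without a sign, so `ε sA_μ = ∂_μ w + [A_μ, w]` for `w
  -- = εC`.
  have e : A μ x + ε • brstA A C μ x = A μ x + pd μ (fun x => ε • C x) x + A μ x * (ε • C x) -
      (ε • C x) * A μ x := by
    rw [hpd, mul_smul_of_even h𝒢 (hA μ x), smul_mul_assoc]
    simp only [brstA, covD, smul_add, smul_sub]
    abel
  rw [← add_mul, ← add_mul, ← sub_mul, e]
  rfl

theorem spectralAction_brst [CompleteSpace G] (h𝒢 : IsSupercommutative 𝒢)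
    {γ : Fin 4 → Matrix (Fin 4) (Fin 4) ℂ} (hγ : IsGamma γ) (c : CutOff) (F : Set E4)
    (hAs : ∀ μ, SmoothMat (A μ)) (hA : ∀ μ x, HasParity 𝒢 0 (A μ x))
    (hCs : SmoothMat C) (hC : ∀ x, HasParity 𝒢 1 (C x)) (hε : ε ∈ 𝒢 1) :
    spectralAction c γ F (fun μ x => A μ x + ε • brstA A C μ x) = spectralAction c γ F A := by
  simp only [spectralAction, seeleyDeWitt_brst h𝒢 hγ hAs hA hCs hC hε]

theorem lap_iterate_add_left_smul {B D : MatField N G} (hB : SmoothMat B) (hD : SmoothMat D)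
    (g : G) (k : ℕ) :
    lap^[k] (fun x => B x + g • D x) = fun x => (lap^[k] B) x + g • (lap^[k] D) x := by
  induction k with
  | zero => rfl
  | succ k ih =>
    funext x
    rw [Function.iterate_succ_apply', ih, lap_add (hB.lap_iterate k)
      ((hD.lap_iterate k).left_smul g), lap_left_smul g (hD.lap_iterate k),
      Function.iterate_succ_apply', Function.iterate_succ_apply']

theorem integral_left_mul {F : Set E4} {f : E4 → G} [CompleteSpace G] (hf : IntegrableOn f F)
    (g : G) : ∫ x in F, g * f x = g * ∫ x in F, f x :=
  (ContinuousLinearMap.mul ℝ G g).integral_comp_comm hf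

variable {Γ : Type*} [Group Γ] {ρ : Γ →* Matrix.specialUnitaryGroup (Fin N) ℂ}
  [MulAction Γ E4] [IsIsometricSMul Γ E4]
  [ProperlyDiscontinuousSMul Γ E4] [CompactSpace (MulAction.orbitRel.Quotient Γ E4)]
  {F : Set E4} [CompleteSpace G]

/-- The variation of the quadratic form of the gauge-fixing term. -/
theorem setIntegral_gaugeFixing_variation (h𝒢 : IsSupercommutative 𝒢)
    (hF : IsFundamentalDomain Γ F volume) {d b : MatField N G} (hd : SmoothMat d)
    (hb : SmoothMat b) (hd' : IsAdjSection ρ d) (hb' : IsAdjSection ρ b)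
    (hdp : ∀ x, HasParity 𝒢 0 (d x)) (hbp : ∀ x, HasParity 𝒢 1 (b x)) (hε : ε ∈ 𝒢 1) (k : ℕ) :
    ∫ x in F, ((d x + ε • b x) * (lap^[k] fun x => d x + ε • b x) x).trace =
      (∫ x in F, (d x * (lap^[k] d) x).trace) +
        (2 : ℝ) • (ε * ∫ x in F, (d x * (lap^[k] b) x).trace) := by
  have h1 : ∀ x, ((d x + ε • b x) * (lap^[k] fun x => d x + ε • b x) x).trace =
      (d x * (lap^[k] d) x).trace +
        (ε * (d x * (lap^[k] b) x).trace + ε * (b x * (lap^[k] d) x).trace) := fun x => by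
    rw [lap_iterate_add_left_smul hd hb, add_mul, mul_add, mul_add,
      smul_mul_smul_of_odd h𝒢 (hbp x) hε, mul_smul_of_even h𝒢 (hdp x), smul_mul_assoc,
      Matrix.trace_add, Matrix.trace_add, Matrix.trace_add, Matrix.trace_smul, Matrix.trace_smul,
      Matrix.trace_zero, add_zero, smul_eq_mul, smul_eq_mul, add_assoc]
  have hi1 := integrableOn_trace_mul hF hd (hd.lap_iterate k) hd' (hd'.lap_iterate hd k)
  have hi2 := integrableOn_trace_mul hF hd (hb.lap_iterate k) hd' (hb'.lap_iterate hb k)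
  have hi3 := integrableOn_trace_mul hF hb (hd.lap_iterate k) hb' (hd'.lap_iterate hd k)
  -- The two cross terms agree by symmetry of `Δ^k` and because the even matrix `d` may be cycled
  -- under the trace; this gives the factor 2.
  have h2 : ∫ x in F, (b x * (lap^[k] d) x).trace = ∫ x in F, (d x * (lap^[k] b) x).trace := by
    rw [setIntegral_trace_mul_lap_iterate hF hb hd hb' hd']
    simp only [fun x => trace_mul_comm_of_even h𝒢 (hdp x)]
  simp only [h1]
  have hi4 : IntegrableOn (fun x => ε * (d x * (lap^[k] b) x).trace +
      ε * (b x * (lap^[k] d) x).trace) F := (hi2.const_mul ε).add (hi3.const_mul ε)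
  rw [integral_add hi1 hi4,
    integral_add (hi2.const_mul ε) (hi3.const_mul ε), integral_left_mul hi2,
    integral_left_mul hi3, h2, two_smul]

/-- The variation of the ghost term under the variation of the antighost. -/
theorem setIntegral_ghost_variation (hF : IsFundamentalDomain Γ F volume)
    {u d : MatField N G} {B : Fin 4 → MatField N G} (hu : SmoothMat u) (hd : SmoothMat d)
    (hB : ∀ μ, SmoothMat (B μ)) (hu' : IsAdjSection ρ u) (hd' : IsAdjSection ρ d)
    (hB' : IsAdjOneForm ρ B) (r : ℝ) (k : ℕ) :
    ∫ x in F, ∑ μ, (pd μ (fun x => u x + ε • r • d x) x * (lap^[k] (B μ)) x).trace =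
      (∫ x in F, ∑ μ, (pd μ u x * (lap^[k] (B μ)) x).trace) -
        r • (ε * ∫ x in F, (d x * (lap^[k] (divergence B)) x).trace) := by
  have h1 : ∀ x, ∑ μ, (pd μ (fun x => u x + ε • r • d x) x * (lap^[k] (B μ)) x).trace =
      ∑ μ, (pd μ u x * (lap^[k] (B μ)) x).trace +
        ε * (r • ∑ μ, (pd μ d x * (lap^[k] (B μ)) x).trace) := fun x => by
    rw [Finset.smul_sum, Finset.mul_sum, ← Finset.sum_add_distrib]
    refine Finset.sum_congr rfl fun μ _ => ?_
    rw [pd_add hu ((hd.real_smul r).left_smul ε), pd_left_smul ε (hd.real_smul r),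
      pd_real_smul r hd, add_mul, smul_mul_assoc, smul_mul_assoc, Matrix.trace_add,
      Matrix.trace_smul, Matrix.trace_smul, smul_eq_mul]
  have hBk : ∀ μ, SmoothMat (lap^[k] (B μ)) := fun μ => (hB μ).lap_iterate k
  have hi1 := integrableOn_sum_trace_mul hF (fun μ => hu.pd μ) hBk (hu'.pd hu)
    (hB'.lap_iterate hB k)
  have hi2 : IntegrableOn (fun x => r • ∑ μ, (pd μ d x * (lap^[k] (B μ)) x).trace) F :=
    (integrableOn_sum_trace_mul hF (fun μ => hd.pd μ) hBk (hd'.pd hd)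
      (hB'.lap_iterate hB k)).smul r
  simp only [h1]
  rw [integral_add hi1 (hi2.const_mul ε), integral_left_mul hi2, integral_smul,
    setIntegral_trace_pd_mul hF hd hBk hd' (hB'.lap_iterate hB k), divergence_lap_iterate hB,
    smul_neg, mul_neg, ← sub_eq_add_neg, mul_smul_comm]

theorem gaugeFixing_add_ghostAction_brst (h𝒢 : IsSupercommutative 𝒢)
    (hF : IsFundamentalDomain Γ F volume) (c : CutOff) {ξ : ℝ} {Cbar : MatField N G}
    (hA : IsGaugeField 𝒢 ρ A) (hCbar : IsGhostField 𝒢 ρ Cbar) (hC : IsGhostField 𝒢 ρ C)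
    (hε : ε ∈ 𝒢 1) :
    gaugeFixing c ξ F (fun μ x => A μ x + ε • brstA A C μ x) +
      ghostAction c F (fun μ x => A μ x + ε • brstA A C μ x)
        (fun x => Cbar x + ε • brstCbar ξ A x) (fun x => C x + ε • brstC C x) =
      gaugeFixing c ξ F A + ghostAction c F A Cbar C := by
  have hAs : ∀ μ, SmoothMat (A μ) := fun μ => (hA.smoothSU μ).smooth
  have hAp : ∀ μ x, HasParity 𝒢 0 (A μ x) := fun μ => (hA.smoothSU μ).mem
  have hCs : SmoothMat C := hC.smoothSU.smooth
  have hCp : ∀ x, HasParity 𝒢 1 (C x) := hC.smoothSU.mem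
  have hus : SmoothMat Cbar := hCbar.smoothSU.smooth
  have hBs : ∀ μ, SmoothMat (covD A C μ) := SmoothMat.covD hAs hCs
  have hB' : IsAdjOneForm ρ (covD A C) := hA.equivariant.covD hCs hC.equivariant
  have hds := SmoothMat.divergence hAs
  have hd' := hA.equivariant.divergence hAs
  have hbs := SmoothMat.divergence hBs
  have hb' := hB'.divergence hBs
  have hdiv : divergence (fun μ x => A μ x + ε • brstA A C μ x) =
      fun x => divergence A x + ε • divergence (covD A C) x := by
    funext x
    simp only [divergence, Finset.smul_sum, ← Finset.sum_add_distrib]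
    refine Finset.sum_congr rfl fun μ _ => ?_
    exact (pd_add (hAs μ) ((hBs μ).left_smul ε) μ x).trans
      (congrArg _ (pd_left_smul ε (hBs μ) μ x))
  simp only [gaugeFixing, ghostAction]
  rw [← map_add, ← map_add]
  congr 1
  ext j
  simp only [map_add, PowerSeries.coeff_mk, phiOp, mul_smul_comm, Matrix.trace_smul,
    ← Finset.smul_sum, integral_smul, hdiv, covD_brst h𝒢 hAp hCs hCp hε, brstCbar]
  rw [setIntegral_gaugeFixing_variation h𝒢 hF hds hbs hd' hb'
    (HasParity.divergence h𝒢 hAs hAp)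
    (HasParity.divergence h𝒢 hBs (covD_parity h𝒢 hAp hCs hCp)) hε,
    setIntegral_ghost_variation hF hus hds hBs hCbar.equivariant hd' hB']
  -- The gauge-fixing variation has coefficient `-(1/2ξ) · 2`, the ghost variation `+ξ⁻¹`, where one
  -- sign of the latter comes from integrating by parts. At `ξ = 0` both sides are zero by the
  -- convention for division.
  have hξ' : (1 / (2 * ξ)) * 2 = ξ⁻¹ := by
    rcases eq_or_ne ξ 0 with rfl | h
    · simp
    · field_simp
  rw [← hξ']
  module

end BRST

end SpectralYM

end

theorem mainTheorem2
    -- the closed flat manifold `E4 / Γ`, with fundamental domain `F`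
    {Γ : Type*} [Group Γ] [MulAction Γ SpectralYM.E4] [IsIsometricSMul Γ SpectralYM.E4]
    [ProperlyDiscontinuousSMul Γ SpectralYM.E4]
    [CompactSpace (MulAction.orbitRel.Quotient Γ SpectralYM.E4)]
    (hfree : ∀ (s : Γ) (x : SpectralYM.E4), s • x = x → s = 1)
    (F : Set SpectralYM.E4) (hF : IsFundamentalDomain Γ F volume)
    -- the `SU(N)`-bundle with its flat background connection
    (N : ℕ) (ρ : Γ →* Matrix.specialUnitaryGroup (Fin N) ℂ)
    -- the Grassmann coefficients
    {G : Type*} [NormedRing G] [NormedAlgebra ℂ G] [CompleteSpace G]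
    (𝒢 : ZMod 2 → Submodule ℂ G) [GradedAlgebra 𝒢] (h𝒢 : SpectralYM.IsSupercommutative 𝒢)
    -- gamma matrices, cut-off function, gauge parameter
    (γ : Fin 4 → Matrix (Fin 4) (Fin 4) ℂ) (hγ : SpectralYM.IsGamma γ)
    (c : SpectralYM.CutOff) (ξ : ℝ) (hξ : ξ ≠ 0)
    -- the fields
    (A : Fin 4 → SpectralYM.MatField N G) (hA : SpectralYM.IsGaugeField 𝒢 ρ A)
    (Cbar C : SpectralYM.MatField N G)
    (hCbar : SpectralYM.IsGhostField 𝒢 ρ Cbar) (hC : SpectralYM.IsGhostField 𝒢 ρ C)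
    -- the odd parameter of the transformation `Φ ↦ Φ + ε • s Φ`
    (ε : G) (hε : ε ∈ 𝒢 1) :
    SpectralYM.totalAction c γ ξ F
        (fun μ x => A μ x + ε • SpectralYM.brstA A C μ x)
        (fun x => Cbar x + ε • SpectralYM.brstCbar ξ A x)
        (fun x => C x + ε • SpectralYM.brstC C x) =
      SpectralYM.totalAction c γ ξ F A Cbar C := by
  rw [SpectralYM.totalAction, SpectralYM.totalAction, add_assoc, add_assoc,
    SpectralYM.spectralAction_brst h𝒢 hγ c F (fun μ => (hA.smoothSU μ).smooth)
      (fun μ => (hA.smoothSU μ).mem) hC.smoothSU.smooth hC.smoothSU.mem hε,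
    SpectralYM.gaugeFixing_add_ghostAction_brst h𝒢 hF c hA hCbar hC hε]
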